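/- An $n$-space group is a discrete group $\Gamma$ of isometries of Euclidean space $E^n$ with compact orbit space. Isometries are written $b+B$ ($x\mapsto b+Bx$), $I$ is the identity, and $\mathrm{Span}(H)$ is the linear span of $\{a : a+I\in H\}$. A normal subgroup $N$ of $\Gamma$ with $V=\mathrm{Span}(N)$ is complete if $N=\{a+A\in\Gamma : a\in V,\ A \text{ fixes } V^\perp \text{ pointwise}\}$. For every $\gamma=b+B\in\Gamma$, $B$ preserves $V$ and $V^\perp$; write $\overline\gamma=\overline b+\overline B$ and $\gamma'=b'+B'$ for the induced isometries of $V$ and $V^\perp$ ($\overline b,b'$ the orthogonal projections of $b$, and $\overline B,B'$ the restrictions of $B$), $\overline N=\{\overline\nu:\nu\in N\}$, $\Gamma'=\{\gamma':\gamma\in\Gamma\}$, $V/N=V/\overline N$ with the orbit space metric, and, for a map $f$ between such spaces $V$ compatible with orbits, $f_\star$ for the induced map $f_\star(Nv)=Nf(v)$ of orbit spaces. Let $\Xi:\Gamma/N\to\mathrm{Isom}(V/N)$, $\Xi(N\gamma)=\overline\gamma_\star$; let $P:\Gamma/N\to\Gamma'$ be the isomorphism $P(N\gamma)=\gamma'$;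 let $p:\Gamma/N\to V^\perp$, $p(N(b+B))=b'$; let $\mathcal K$ be the connected component of the identity of $\mathrm{Isom}(V/N)$; and let $Z(N)$ be the center of $N$. **Theorem 3.** Let $N_i$ be a complete normal subgroup of an $n$-space group $\Gamma_i$, with $V_i,\Xi_i,P_i,p_i,\mathcal K_i$ as above, for $i=1,2$. Let $\alpha:V_1\to V_2$ and $\beta:V_1^\perp\to V_2^\perp$ be affinities with $\alpha\overline N_1\alpha^{-1}=\overline N_2$ and $\beta\Gamma_1'\beta^{-1}=\Gamma_2'$. Put $\alpha_\sharp(\chi)=\alpha_\star\chi\alpha_\star^{-1}$ and $\beta_*(\gamma')=\beta\gamma'\beta^{-1}$, and write $\alpha=\overline c+\overline C$ with $\overline c\in V_2$ and $\overline C$ linear. Let $D:V_1^\perp\to\mathrm{Span}(Z(N_2))$ be a linear transformation with $DB'=\overline C\,\overline B\,\overline C^{-1}D$ for all $b+B\in\Gamma_1$. Then $\mathcal K_i=\{(v+\overline I)_\star : v\in\mathrm{Span}(Z(N_i))\}$ for $i=1,2$, and the following are equivalent: 1. There is an affinity $\phi=c+C$ of $E^n$ with $\phi\Gamma_1\phi^{-1}=\Gamma_2$,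 $\phi N_1\phi^{-1}=N_2$, $\overline\phi=\alpha$, $\phi'=\beta$ and $\overline{C'}=D$. Here $\overline\phi=\overline c+\overline C:V_1\to V_2$ and $\phi'=c'+C':V_1^\perp\to V_2^\perp$, where $\overline c,c'$ are the orthogonal projections of $c$ to $V_2,V_2^\perp$, $\overline C$ is the restriction of $C$ to $V_1$, and $\overline{C'},C'$ are the restriction of $C$ to $V_1^\perp$ followed by the orthogonal projections to $V_2$ and $V_2^\perp$. 2. $\Xi_2P_2^{-1}\beta_*P_1=(Dp_1)_\star\,\alpha_\sharp\Xi_1$ (pointwise product on $\Gamma_1/N_1$), where $(Dp_1)_\star(N_1(b+B))=(Db'+\overline I)_\star$. 3. $\alpha_\sharp^{-1}\Xi_2P_2^{-1}\beta_*P_1=(\overline C^{-1}Dp_1)_\star\,\Xi_1$, where $(\overline C^{-1}Dp_1)_\star(N_1(b+B))=(\overline C^{-1}Db'+\overline I)_\star$. Moreover $(Dp_1)_\star:\Gamma_1/N_1\to\mathcal K_2$ is a crossed homomorphism for the action $N_1(b+B)\cdot(v+\overline I)_\star=(\overline C\,\overline B\,\overline C^{-1}v+\overline I)_\star$ of $\Gamma_1/N_1$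 on $\mathcal K_2$; and $\overline C^{-1}D$ maps $V_1^\perp$ into $\mathrm{Span}(Z(N_1))$ and $(\overline C^{-1}Dp_1)_\star:\Gamma_1/N_1\to\mathcal K_1$ is a crossed homomorphism for the action $N_1(b+B)\cdot(v+\overline I)_\star=(\overline Bv+\overline I)_\star$ of $\Gamma_1/N_1$ on $\mathcal K_1$. -/

import Mathlib

open Filter Topology

noncomputable section

/-! ### The isometry group of a metric space as a topological group -/

section IsometryGroup

variable {X : Type*} [PseudoMetricSpace X]

/-- The group `Isom(X)` carries the compact-open topology. -/
instance isomTopology : TopologicalSpace (X ≃ᵢ X) :=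
  TopologicalSpace.induced (fun f => (⟨f, f.continuous⟩ : C(X, X))) inferInstance

theorem isom_tendsto_iff {ι : Type*} {p : Filter ι} {F : ι → X ≃ᵢ X} {f : X ≃ᵢ X} :
    Tendsto F p (𝓝 f) ↔ ∀ K : Set X, IsCompact K → ∀ ε > 0, ∀ᶠ i in p, ∀ x ∈ K,
      dist (f x) (F i x) < ε := by
  rw [nhds_induced, tendsto_comap_iff, ContinuousMap.tendsto_iff_forall_isCompact_tendstoUniformlyOn]
  simp only [Metric.tendstoUniformlyOn_iff]
  rfl

instance isomIsTopologicalGroup : IsTopologicalGroup (X ≃ᵢ X) where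
  continuous_mul := by
    rw [continuous_iff_continuousAt]
    rintro ⟨f, g⟩
    have hf := isom_tendsto_iff.1 (continuous_fst.continuousAt (x := (f, g)))
    have hg := isom_tendsto_iff.1 (continuous_snd.continuousAt (x := (f, g)))
    refine isom_tendsto_iff.2 fun K hK ε hε => ?_
    filter_upwards [hf _ (hK.image g.continuous) _ (half_pos hε), hg _ hK _ (half_pos hε)]
      with p h1 h2 x hx
    have e1 := h1 (g x) ⟨x, hx, rfl⟩
    have e2 := h2 x hx
    have e3 := dist_triangle (f (g x)) (p.1 (g x)) (p.1 (p.2 x))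
    rw [p.1.dist_eq] at e3
    change dist (f (g x)) (p.1 (p.2 x)) < ε
    linarith
  continuous_inv := by
    rw [continuous_iff_continuousAt]
    intro f
    have hf := isom_tendsto_iff.1 (continuousAt_id (x := f))
    refine isom_tendsto_iff.2 fun K hK ε hε => ?_
    filter_upwards [hf _ (hK.image f.symm.continuous) _ hε] with g h x hx
    have e := h (f.symm x) ⟨x, hx, rfl⟩
    simp only [id, f.apply_symm_apply] at e
    rw [dist_comm] at e
    change dist (f.symm x) (g.symm x) < ε
    rw [← g.dist_eq, g.apply_symm_apply]
    exact e

end IsometryGroup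

/-! ### Groups of isometries of a Euclidean vector space and their orbit spaces -/

section Orbit

variable {W : Type*} [NormedAddCommGroup W] [InnerProductSpace ℝ W]
variable {W' : Type*} [NormedAddCommGroup W'] [InnerProductSpace ℝ W']

/-- The isometries `b + B` of a Euclidean vector space carry the compact-open topology. -/
instance affineIsomTopology : TopologicalSpace (W ≃ᵃⁱ[ℝ] W) :=
  TopologicalSpace.induced AffineIsometryEquiv.toIsometryEquiv inferInstance

/-- The linear part `B` of the isometry `γ = b + B`; the vector `b` is `γ 0`. -/
abbrev linPart (γ : W ≃ᵃⁱ[ℝ] W) : W ≃ₗᵢ[ℝ] W := γ.linearIsometryEquiv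

theorem isom_apply (γ : W ≃ᵃⁱ[ℝ] W) (x : W) : γ x = γ 0 + linPart γ x := by
  have := γ.map_vadd 0 x
  simp only [vadd_eq_add, add_zero] at this
  rw [this, add_comm]

/-- The translation `a + I`. -/
abbrev transl (a : W) : W ≃ᵃⁱ[ℝ] W := AffineIsometryEquiv.constVAdd ℝ W a

theorem conj_transl (γ : W ≃ᵃⁱ[ℝ] W) (a : W) : γ * transl a * γ⁻¹ = transl (linPart γ a) := by
  ext1 x
  change γ (a + γ.symm x) = linPart γ a + x
  rw [isom_apply γ (a + _), map_add, add_left_comm, ← isom_apply, γ.apply_symm_apply]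

/-- The orbit equivalence relation of a group of isometries. -/
def orbitSetoid (H : Subgroup (W ≃ᵃⁱ[ℝ] W)) : Setoid W where
  r x y := ∃ h ∈ H, h x = y
  iseqv :=
    { refl := fun x => ⟨1, H.one_mem, rfl⟩
      symm := by
        rintro x y ⟨h, hh, rfl⟩
        exact ⟨h⁻¹, H.inv_mem hh, h.symm_apply_apply x⟩
      trans := by
        rintro x y z ⟨h, hh, rfl⟩ ⟨k, hk, rfl⟩
        exact ⟨k * h, H.mul_mem hk hh, rfl⟩ }

/-- The orbit space `W/H`. -/
def OrbitSpace (H : Subgroup (W ≃ᵃⁱ[ℝ] W)) : Type _ := Quotient (orbitSetoid H)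

/-- The orbit `H x`. -/
def orbitMk (H : Subgroup (W ≃ᵃⁱ[ℝ] W)) (x : W) : OrbitSpace H := Quotient.mk (orbitSetoid H) x

theorem orbitMk_eq_iff (H : Subgroup (W ≃ᵃⁱ[ℝ] W)) {x y : W} :
    orbitMk H x = orbitMk H y ↔ ∃ h ∈ H, h x = y :=
  Quotient.eq (r := orbitSetoid H)

theorem orbit_bdd (H : Subgroup (W ≃ᵃⁱ[ℝ] W)) (x y : W) :
    BddBelow (Set.range fun h : H => dist x (h.1 y)) :=
  ⟨0, by rintro _ ⟨h, rfl⟩; exact dist_nonneg⟩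

theorem orbit_dist_le (H : Subgroup (W ≃ᵃⁱ[ℝ] W)) {g g' : W ≃ᵃⁱ[ℝ] W} (hg : g ∈ H) (hg' : g' ∈ H)
    (x y : W) : ⨅ h : H, dist (g x) (h.1 (g' y)) ≤ ⨅ h : H, dist x (h.1 y) := by
  refine le_ciInf fun h => ?_
  refine (ciInf_le (orbit_bdd H _ _)
    ⟨g * h.1 * g'⁻¹, H.mul_mem (H.mul_mem hg h.2) (H.inv_mem hg')⟩).trans (le_of_eq ?_)
  have : (g * h.1 * g'⁻¹) (g' y) = g (h.1 y) := by
    change g (h.1 (g'.symm (g' y))) = _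
    rw [g'.symm_apply_apply]
  rw [this, g.dist_map]

/-- The distance between two orbits, `inf {|x - h y| : h ∈ H}`. -/
def orbitDist (H : Subgroup (W ≃ᵃⁱ[ℝ] W)) (p q : OrbitSpace H) : ℝ :=
  Quotient.liftOn₂ p q (fun x y => ⨅ h : H, dist x (h.1 y)) (by
    rintro x y _ _ ⟨g, hg, rfl⟩ ⟨g', hg', rfl⟩
    refine le_antisymm ?_ (orbit_dist_le H hg hg' x y)
    have := orbit_dist_le H (H.inv_mem hg) (H.inv_mem hg') (g x) (g' y)
    have e1 : g⁻¹ (g x) = x := g.symm_apply_apply x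
    have e2 : g'⁻¹ (g' y) = y := g'.symm_apply_apply y
    rwa [e1, e2] at this)

/-- The orbit space `W/H` with the orbit space metric
(a genuine metric as soon as all orbits are closed, in particular for discrete `H`). -/
instance orbitPseudoMetric (H : Subgroup (W ≃ᵃⁱ[ℝ] W)) : PseudoMetricSpace (OrbitSpace H) where
  dist := orbitDist H
  dist_self := by
    rintro ⟨x⟩
    refine le_antisymm ?_ (le_ciInf fun h => dist_nonneg)
    exact (ciInf_le (orbit_bdd H x x) 1).trans (le_of_eq (dist_self x))
  dist_comm := by
    have key : ∀ x y : W, (⨅ h : H, dist x (h.1 y)) ≤ ⨅ h : H, dist y (h.1 x) := by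
      intro x y
      refine le_ciInf fun h => (ciInf_le (orbit_bdd H x y) h⁻¹).trans (le_of_eq ?_)
      rw [← h.1.dist_map, dist_comm]
      congr 1
      exact h.1.apply_symm_apply y
    rintro ⟨x⟩ ⟨y⟩
    exact le_antisymm (key x y) (key y x)
  dist_triangle := by
    rintro ⟨x⟩ ⟨y⟩ ⟨z⟩
    change (⨅ h : H, dist x (h.1 z)) ≤ (⨅ h : H, dist x (h.1 y)) + ⨅ h : H, dist y (h.1 z)
    refine le_ciInf_add_ciInf fun h k => (ciInf_le (orbit_bdd H x z) (h * k)).trans ?_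
    refine (dist_triangle x (h.1 y) _).trans (add_le_add le_rfl (le_of_eq ?_))
    exact h.1.dist_map y (k.1 z)

theorem orbit_normalizer_le (H : Subgroup (W ≃ᵃⁱ[ℝ] W)) {a : W ≃ᵃⁱ[ℝ] W}
    (ha : a ∈ Subgroup.normalizer (H : Set (W ≃ᵃⁱ[ℝ] W))) (x y : W) :
    dist (orbitMk H (a x)) (orbitMk H (a y)) ≤ dist (orbitMk H x) (orbitMk H y) := by
  change (⨅ h : H, dist (a x) (h.1 (a y))) ≤ ⨅ h : H, dist x (h.1 y)
  refine le_ciInf fun h => ?_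
  refine (ciInf_le (orbit_bdd H _ _)
    ⟨a * h.1 * a⁻¹, (Subgroup.mem_normalizer_iff.1 ha h.1).1 h.2⟩).trans (le_of_eq ?_)
  have : (a * h.1 * a⁻¹) (a y) = a (h.1 y) := by
    change a (h.1 (a.symm (a y))) = _
    rw [a.symm_apply_apply]
  rw [this, a.dist_map]

theorem orbit_normalizer_eq (H : Subgroup (W ≃ᵃⁱ[ℝ] W)) {a : W ≃ᵃⁱ[ℝ] W}
    (ha : a ∈ Subgroup.normalizer (H : Set (W ≃ᵃⁱ[ℝ] W))) {x y : W}
    (hxy : orbitMk H x = orbitMk H y) : orbitMk H (a x) = orbitMk H (a y) := by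
  obtain ⟨h, hh, rfl⟩ := (orbitMk_eq_iff H).1 hxy
  refine (orbitMk_eq_iff H).2
    ⟨a * h * a⁻¹, (Subgroup.mem_normalizer_iff.1 ha h).1 hh, ?_⟩
  change a (h (a.symm (a x))) = _
  rw [a.symm_apply_apply]

/-- For an isometry `a` of `W` normalizing `H`, the isometry `a_⋆` of `W/H`, `a_⋆(H x) = H a(x)`. -/
def starHom (H : Subgroup (W ≃ᵃⁱ[ℝ] W)) :
    Subgroup.normalizer (H : Set (W ≃ᵃⁱ[ℝ] W)) →* (OrbitSpace H ≃ᵢ OrbitSpace H) where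
  toFun a :=
    { toFun := Quotient.lift (fun x => orbitMk H (a.1 x))
        fun _ _ h => orbit_normalizer_eq H a.2 (Quotient.sound h)
      invFun := Quotient.lift (fun x => orbitMk H ((a⁻¹).1 x))
        fun _ _ h => orbit_normalizer_eq H (a⁻¹).2 (Quotient.sound h)
      left_inv := by
        rintro ⟨x⟩
        exact congrArg (orbitMk H) (a.1.symm_apply_apply x)
      right_inv := by
        rintro ⟨x⟩
        exact congrArg (orbitMk H) (a.1.apply_symm_apply x)
      isometry_toFun := by
        refine Isometry.of_dist_eq ?_
        rintro ⟨x⟩ ⟨y⟩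
        refine le_antisymm (orbit_normalizer_le H a.2 x y) ?_
        have := orbit_normalizer_le H (a⁻¹).2 (a.1 x) (a.1 y)
        have e1 : (a⁻¹).1 (a.1 x) = x := a.1.symm_apply_apply x
        have e2 : (a⁻¹).1 (a.1 y) = y := a.1.symm_apply_apply y
        rwa [e1, e2] at this }
  map_one' := by
    ext ⟨x⟩
    rfl
  map_mul' a b := by
    ext ⟨x⟩
    rfl

@[simp] theorem starHom_mk (H : Subgroup (W ≃ᵃⁱ[ℝ] W))
    (a : Subgroup.normalizer (H : Set (W ≃ᵃⁱ[ℝ] W))) (x : W) :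
    starHom H a (orbitMk H x) = orbitMk H (a.1 x) := rfl

/-- The affinity `α a α⁻¹`. -/
def affConj (α : W ≃ᵃ[ℝ] W') (a : W ≃ᵃⁱ[ℝ] W) : W' ≃ᵃ[ℝ] W' :=
  (α.symm.trans a.toAffineEquiv).trans α

/-- `α H α⁻¹ = H'`, an equality of sets of affinities of `W'`. -/
def Conjugates (α : W ≃ᵃ[ℝ] W') (H : Subgroup (W ≃ᵃⁱ[ℝ] W)) (H' : Subgroup (W' ≃ᵃⁱ[ℝ] W')) :
    Prop :=
  affConj α '' (H : Set (W ≃ᵃⁱ[ℝ] W)) =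
    AffineIsometryEquiv.toAffineEquiv '' (H' : Set (W' ≃ᵃⁱ[ℝ] W'))

theorem affConj_affConj {α : W ≃ᵃ[ℝ] W'} {a : W ≃ᵃⁱ[ℝ] W} {b : W' ≃ᵃⁱ[ℝ] W'}
    (h : affConj α a = b.toAffineEquiv) : affConj α.symm b = a.toAffineEquiv := by
  ext x
  change α.symm (b.toAffineEquiv (α x)) = a x
  rw [← h]
  change α.symm (α (a (α.symm (α x)))) = a x
  simp

theorem Conjugates.symm {α : W ≃ᵃ[ℝ] W'} {H : Subgroup (W ≃ᵃⁱ[ℝ] W)}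
    {H' : Subgroup (W' ≃ᵃⁱ[ℝ] W')} (h : Conjugates α H H') : Conjugates α.symm H' H := by
  ext f
  constructor
  · rintro ⟨b, hb, rfl⟩
    obtain ⟨a, ha, e⟩ := (Eq.symm h).subset ⟨b, hb, rfl⟩
    exact ⟨a, ha, (affConj_affConj e).symm⟩
  · rintro ⟨a, ha, rfl⟩
    obtain ⟨b, hb, e⟩ := Eq.subset h ⟨a, ha, rfl⟩
    exact ⟨b, hb, affConj_affConj (Eq.symm e)⟩

theorem Conjugates.orbit_eq {α : W ≃ᵃ[ℝ] W'} {H : Subgroup (W ≃ᵃⁱ[ℝ] W)}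
    {H' : Subgroup (W' ≃ᵃⁱ[ℝ] W')} (h : Conjugates α H H') {x y : W}
    (hxy : orbitMk H x = orbitMk H y) : orbitMk H' (α x) = orbitMk H' (α y) := by
  obtain ⟨a, ha, rfl⟩ := (orbitMk_eq_iff H).1 hxy
  obtain ⟨b, hb, e⟩ := Eq.subset h ⟨a, ha, rfl⟩
  refine (orbitMk_eq_iff H').2 ⟨b, hb, ?_⟩
  change b.toAffineEquiv (α x) = _
  rw [e]
  change α (a (α.symm (α x))) = _
  simp

/-- `α_⋆ : W/H → W'/H'`, `α_⋆(H x) = H' α(x)`, for an affinity `α` with `α H α⁻¹ = H'`. -/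
def affStar (α : W ≃ᵃ[ℝ] W') {H : Subgroup (W ≃ᵃⁱ[ℝ] W)} {H' : Subgroup (W' ≃ᵃⁱ[ℝ] W')}
    (h : Conjugates α H H') : OrbitSpace H ≃ OrbitSpace H' where
  toFun := Quotient.lift (fun x => orbitMk H' (α x)) fun _ _ e => h.orbit_eq (Quotient.sound e)
  invFun := Quotient.lift (fun x => orbitMk H (α.symm x))
    fun _ _ e => h.symm.orbit_eq (Quotient.sound e)
  left_inv := by
    rintro ⟨x⟩
    exact congrArg (orbitMk H) (α.symm_apply_apply x)
  right_inv := by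
    rintro ⟨x⟩
    exact congrArg (orbitMk H') (α.apply_symm_apply x)

/-- `α_♯(χ) = α_⋆ χ α_⋆⁻¹`, on all self-bijections `χ` of `W/H`. -/
def affSharp (α : W ≃ᵃ[ℝ] W') {H : Subgroup (W ≃ᵃⁱ[ℝ] W)} {H' : Subgroup (W' ≃ᵃⁱ[ℝ] W')}
    (h : Conjugates α H H') :
    Equiv.Perm (OrbitSpace H) ≃* Equiv.Perm (OrbitSpace H') :=
  (affStar α h).permCongrHom

theorem Conjugates.exists_isom {α : W ≃ᵃ[ℝ] W'} {H : Subgroup (W ≃ᵃⁱ[ℝ] W)}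
    {H' : Subgroup (W' ≃ᵃⁱ[ℝ] W')} (h : Conjugates α H H') (a : H) :
    ∃ b : H', b.1.toAffineEquiv = affConj α a.1 := by
  obtain ⟨b, hb, e⟩ := Eq.subset h ⟨a.1, a.2, rfl⟩
  exact ⟨⟨b, hb⟩, e⟩

/-- `α_∗ : H → H'`, `α_∗(a) = α a α⁻¹`, for an affinity `α` with `α H α⁻¹ = H'`. -/
def conjIso (α : W ≃ᵃ[ℝ] W') {H : Subgroup (W ≃ᵃⁱ[ℝ] W)} {H' : Subgroup (W' ≃ᵃⁱ[ℝ] W')}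
    (h : Conjugates α H H') : H ≃* H' where
  toFun a := (h.exists_isom a).choose
  invFun b := (h.symm.exists_isom b).choose
  left_inv a := by
    apply Subtype.ext
    apply AffineIsometryEquiv.toAffineEquiv_injective
    rw [(h.symm.exists_isom _).choose_spec]
    exact affConj_affConj (h.exists_isom a).choose_spec.symm
  right_inv b := by
    apply Subtype.ext
    apply AffineIsometryEquiv.toAffineEquiv_injective
    rw [(h.exists_isom _).choose_spec]
    exact affConj_affConj (h.symm.exists_isom b).choose_spec.symm
  map_mul' a a' := by
    apply Subtype.ext
    apply AffineIsometryEquiv.toAffineEquiv_injective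
    rw [(h.exists_isom _).choose_spec]
    ext x
    change α (a.1 (a'.1 (α.symm x))) =
      (h.exists_isom a).choose.1.toAffineEquiv ((h.exists_isom a').choose.1.toAffineEquiv x)
    rw [(h.exists_isom a).choose_spec, (h.exists_isom a').choose_spec]
    change _ = α (a.1 (α.symm (α (a'.1 (α.symm x)))))
    simp

theorem conjIso_spec (α : W ≃ᵃ[ℝ] W') {H : Subgroup (W ≃ᵃⁱ[ℝ] W)}
    {H' : Subgroup (W' ≃ᵃⁱ[ℝ] W')} (h : Conjugates α H H') (a : H) :
    (conjIso α h a).1.toAffineEquiv = affConj α a.1 := (h.exists_isom a).choose_spec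

/-- `Span(H)`, the linear span of the vectors `a` such that `a + I` is in `H`. -/
def transSpan (H : Subgroup (W ≃ᵃⁱ[ℝ] W)) : Submodule ℝ W :=
  Submodule.span ℝ {a | transl a ∈ H}

/-- A space group: a discrete group of isometries with compact orbit space. -/
structure IsSpaceGroup (Γ : Subgroup (W ≃ᵃⁱ[ℝ] W)) : Prop where
  discrete : DiscreteTopology Γ
  cocompact : CompactSpace (OrbitSpace Γ)

end Orbit

/-! ### Restriction to an invariant subspace -/

section Restrict

variable {E : Type*} [NormedAddCommGroup E] [InnerProductSpace ℝ E]

/-- The restriction to an invariant subspace `U` of the linear part of `γ ∈ Γ`. -/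
def restrictLin (Γ : Subgroup (E ≃ᵃⁱ[ℝ] E)) (U : Submodule ℝ E)
    (hU : ∀ γ ∈ Γ, ∀ u ∈ U, linPart γ u ∈ U) (γ : Γ) : U ≃ₗᵢ[ℝ] U where
  toFun u := ⟨linPart γ.1 u.1, hU γ.1 γ.2 u.1 u.2⟩
  map_add' _ _ := Subtype.ext (map_add _ _ _)
  map_smul' _ _ := Subtype.ext (map_smul _ _ _)
  invFun u := ⟨linPart (γ⁻¹).1 u.1, hU _ (γ⁻¹).2 u.1 u.2⟩
  left_inv u := Subtype.ext ((linPart γ.1).symm_apply_apply u.1)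
  right_inv u := Subtype.ext ((linPart γ.1).apply_symm_apply u.1)
  norm_map' u := (linPart γ.1).norm_map u.1

/-- For `γ = b + B ∈ Γ` and a `Γ`-invariant subspace `U`, the isometry of `U` whose translation
vector is the orthogonal projection of `b` to `U` and whose linear part is the restriction
of `B` to `U`. -/
def restrictHom (Γ : Subgroup (E ≃ᵃⁱ[ℝ] E)) (U : Submodule ℝ E) [U.HasOrthogonalProjection]
    (hU : ∀ γ ∈ Γ, ∀ u ∈ U, linPart γ u ∈ U) : Γ →* (U ≃ᵃⁱ[ℝ] U) where
  toFun γ := AffineIsometryEquiv.mk'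
    (fun u => U.orthogonalProjectionOnto (γ.1 0) + restrictLin Γ U hU γ u)
    (restrictLin Γ U hU γ) 0 (by intro u; simp [add_comm])
  map_one' := by
    ext u
    change ((U.orthogonalProjectionOnto 0 : U) : E) + u.1 = u.1
    simp
  map_mul' γ δ := by
    ext u
    change ((U.orthogonalProjectionOnto (γ.1 (δ.1 0)) : U) : E) + linPart γ.1 (linPart δ.1 u) =
      ((U.orthogonalProjectionOnto (γ.1 0) : U) : E) +
        linPart γ.1 (((U.orthogonalProjectionOnto (δ.1 0) : U) : E) + linPart δ.1 u)
    have key : ((U.orthogonalProjectionOnto (linPart γ.1 (δ.1 0)) : U) : E) =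
        linPart γ.1 ((U.orthogonalProjectionOnto (δ.1 0) : U) : E) := by
      refine Submodule.eq_starProjection_of_mem_of_inner_eq_zero
        (hU _ γ.2 _ (Subtype.property _)) fun w hw => ?_
      rw [← map_sub]
      have e : w = linPart γ.1 (linPart (γ⁻¹).1 w) :=
        ((linPart γ.1).apply_symm_apply w).symm
      rw [e, LinearIsometryEquiv.inner_map_map]
      exact Submodule.starProjection_inner_eq_zero _ _ (hU _ (γ⁻¹).2 _ hw)
    rw [isom_apply γ.1 (δ.1 0), map_add, Submodule.coe_add, key, map_add, add_assoc]

theorem restrictHom_apply (Γ : Subgroup (E ≃ᵃⁱ[ℝ] E)) (U : Submodule ℝ E)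
    [U.HasOrthogonalProjection] (hU : ∀ γ ∈ Γ, ∀ u ∈ U, linPart γ u ∈ U) (γ : Γ) (u : U) :
    restrictHom Γ U hU γ u = U.orthogonalProjectionOnto (γ.1 0) + restrictLin Γ U hU γ u := rfl

end Restrict

/-! ### Affine maps and pairs of subspaces -/

section AffineParts

variable {E : Type*} [NormedAddCommGroup E] [InnerProductSpace ℝ E]

/-- For `φ = c + C`: the map `U₁ → U₂` whose translation vector is the orthogonal projection of `c`
to `U₂` and whose linear part is `C` restricted to `U₁` followed by the orthogonal projection
to `U₂`. -/
def affPart (U₁ U₂ : Submodule ℝ E) [U₂.HasOrthogonalProjection] (φ : E ≃ᵃ[ℝ] E) (u : U₁) : U₂ :=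
  U₂.orthogonalProjectionOnto (φ 0) + U₂.orthogonalProjectionOnto (φ.linear u)

/-- For `φ = c + C`: the linear transformation `C` restricted to `U₁` followed by the orthogonal
projection to `U₂`. -/
def affLinPart (U₁ U₂ : Submodule ℝ E) [U₂.HasOrthogonalProjection] (φ : E ≃ᵃ[ℝ] E) (u : U₁) :
    U₂ :=
  U₂.orthogonalProjectionOnto (φ.linear u)

end AffineParts

/-- `f` is a crossed homomorphism for the action `ρ` of `Q` on `K` by automorphisms. -/
def IsCrossedHom {Q K : Type*} [Group Q] [Group K] (ρ : Q →* MulAut K) (f : Q → K) : Prop :=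
  ∀ g h, f (g * h) = f g * ρ g (f h)

/-! ### Space groups with a complete normal subgroup -/

/-- `N` is a complete normal subgroup of `Γ`: it is normal and, with `V = Span(N)`,
`N = {a + A ∈ Γ : a ∈ V and A fixes every vector of Vᗮ}`. -/
structure IsCompleteNormal {E : Type*} [NormedAddCommGroup E] [InnerProductSpace ℝ E]
    (Γ : Subgroup (E ≃ᵃⁱ[ℝ] E)) (N : Subgroup Γ) : Prop where
  normal : N.Normal
  mem_iff : ∀ γ : Γ, γ ∈ N ↔ γ.1 0 ∈ transSpan (N.map Γ.subtype) ∧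
    ∀ w ∈ (transSpan (N.map Γ.subtype))ᗮ, linPart γ.1 w = w

/-- An `n`-space group `Γ` with a complete normal subgroup `N`. -/
structure SpaceGroupPair (n : ℕ) where
  Γ : Subgroup (EuclideanSpace ℝ (Fin n) ≃ᵃⁱ[ℝ] EuclideanSpace ℝ (Fin n))
  N : Subgroup Γ
  isSpaceGroup : IsSpaceGroup Γ
  isCompleteNormal : IsCompleteNormal Γ N

namespace SpaceGroupPair

variable {n : ℕ} (G : SpaceGroupPair n)

instance : G.N.Normal := G.isCompleteNormal.normal

/-- `N` as a subgroup of the isometry group of `Eⁿ`. -/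
abbrev NE : Subgroup (EuclideanSpace ℝ (Fin n) ≃ᵃⁱ[ℝ] EuclideanSpace ℝ (Fin n)) :=
  G.N.map G.Γ.subtype

/-- `V = Span(N)`. -/
def V : Submodule ℝ (EuclideanSpace ℝ (Fin n)) := transSpan G.NE

theorem lin_mem_V : ∀ γ ∈ G.Γ, ∀ v ∈ G.V, linPart γ v ∈ G.V := by
  intro γ hγ v hv
  induction hv using Submodule.span_induction with
  | mem a ha =>
    obtain ⟨ν, hν, e⟩ := ha
    have e' : ν.1 = transl a := e
    refine Submodule.subset_span ?_
    change transl (linPart γ a) ∈ G.NE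
    rw [← conj_transl, ← e']
    exact ⟨⟨γ, hγ⟩ * ν * ⟨γ, hγ⟩⁻¹, G.isCompleteNormal.normal.conj_mem ν hν ⟨γ, hγ⟩, rfl⟩
  | zero => simp
  | add x y _ _ hx hy => rw [map_add]; exact add_mem hx hy
  | smul r x _ hx => rw [map_smul]; exact Submodule.smul_mem _ _ hx

theorem lin_mem_Vperp : ∀ γ ∈ G.Γ, ∀ w ∈ G.Vᗮ, linPart γ w ∈ G.Vᗮ := by
  intro γ hγ w hw
  rw [Submodule.mem_orthogonal] at hw ⊢
  intro v hv
  have e : v = linPart γ (linPart γ⁻¹ v) := ((linPart γ).apply_symm_apply v).symm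
  rw [e, LinearIsometryEquiv.inner_map_map]
  exact hw _ (G.lin_mem_V _ (G.Γ.inv_mem hγ) _ hv)

/-- `γ = b + B ↦ γ̄ = b̄ + B̄`, an isometry of `V`. -/
def bar : G.Γ →* (G.V ≃ᵃⁱ[ℝ] G.V) := restrictHom G.Γ G.V G.lin_mem_V

/-- `γ = b + B ↦ γ' = b' + B'`, an isometry of `Vᗮ`. -/
def prime : G.Γ →* (G.Vᗮ ≃ᵃⁱ[ℝ] G.Vᗮ) := restrictHom G.Γ G.Vᗮ G.lin_mem_Vperp

/-- The group `N̄` of isometries of `V`. -/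
def Nbar : Subgroup (G.V ≃ᵃⁱ[ℝ] G.V) := G.N.map G.bar

/-- The group `Γ'` of isometries of `Vᗮ`. -/
def Γprime : Subgroup (G.Vᗮ ≃ᵃⁱ[ℝ] G.Vᗮ) := G.prime.range

/-- The orbit space `V/N = V/N̄`. -/
abbrev VmodN : Type := OrbitSpace G.Nbar

theorem ker_prime : G.prime.ker = G.N := by
  ext γ
  rw [G.isCompleteNormal.mem_iff, MonoidHom.mem_ker]
  have h0 : ((G.Vᗮ).orthogonalProjectionOnto (γ.1 0) = 0) ↔ γ.1 0 ∈ G.V := by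
    rw [Submodule.orthogonalProjectionOnto_eq_zero_iff, Submodule.orthogonal_orthogonal]
  constructor
  · intro h
    have h1 : ∀ w, G.prime γ w = w := fun w => by rw [h]; rfl
    have hb : (G.Vᗮ).orthogonalProjectionOnto (γ.1 0) = 0 := by
      have := h1 0
      rwa [prime, restrictHom_apply, LinearIsometryEquiv.map_zero, add_zero] at this
    refine ⟨h0.1 hb, fun w hw => ?_⟩
    have := h1 ⟨w, hw⟩
    rw [prime, restrictHom_apply, hb, zero_add] at this
    exact congrArg Subtype.val this
  · rintro ⟨hb, hB⟩
    ext1 w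
    rw [prime, restrictHom_apply, h0.2 hb, zero_add]
    exact Subtype.ext (hB w.1 w.2)

/-- The isomorphism `P : Γ/N → Γ'`, `P(N γ) = γ'`. -/
def P : G.Γ ⧸ G.N ≃* G.Γprime :=
  (QuotientGroup.quotientMulEquivOfEq G.ker_prime.symm).trans
    (QuotientGroup.quotientKerEquivRange G.prime)

@[simp] theorem P_mk (γ : G.Γ) : (G.P (γ : G.Γ ⧸ G.N) : G.Vᗮ ≃ᵃⁱ[ℝ] G.Vᗮ) = G.prime γ := rfl

/-- `p : Γ/N → Vᗮ`, `p(N(b + B)) = b'`. -/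
def p (g : G.Γ ⧸ G.N) : G.Vᗮ := (G.P g).1 0

theorem p_mk (γ : G.Γ) : G.p (γ : G.Γ ⧸ G.N) = (G.Vᗮ).orthogonalProjectionOnto (γ.1 0) := by
  change G.prime γ 0 = _
  rw [prime, restrictHom_apply, LinearIsometryEquiv.map_zero, add_zero]

theorem bar_mem_normalizer (γ : G.Γ) :
    G.bar γ ∈ Subgroup.normalizer (G.Nbar : Set (G.V ≃ᵃⁱ[ℝ] G.V)) := by
  have key : ∀ γ : G.Γ, ∀ a ∈ G.Nbar, G.bar γ * a * (G.bar γ)⁻¹ ∈ G.Nbar := by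
    rintro γ _ ⟨ν, hν, rfl⟩
    exact ⟨γ * ν * γ⁻¹, G.isCompleteNormal.normal.conj_mem ν hν γ, by simp⟩
  refine Subgroup.mem_normalizer_iff.2 fun a => ⟨key γ a, fun h => ?_⟩
  have := key γ⁻¹ _ h
  rw [map_inv] at this
  simpa [mul_assoc] using this

/-- `Ξ : Γ/N → Isom(V/N)`, `Ξ(N γ) = γ̄_⋆`. -/
def Xi : G.Γ ⧸ G.N →* (G.VmodN ≃ᵢ G.VmodN) :=
  QuotientGroup.lift G.N ((starHom G.Nbar).comp (G.bar.codRestrict _ G.bar_mem_normalizer)) (by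
    intro ν hν
    rw [MonoidHom.mem_ker]
    ext ⟨v⟩
    exact ((orbitMk_eq_iff G.Nbar).2 ⟨G.bar ν, ⟨ν, hν, rfl⟩, rfl⟩).symm)

theorem Xi_mk (γ : G.Γ) (v : G.V) :
    G.Xi (γ : G.Γ ⧸ G.N) (orbitMk G.Nbar v) = orbitMk G.Nbar (G.bar γ v) := rfl

/-- `Span(Z(N))`, the span of the translations in the center of `N`. -/
def spanZ : Submodule ℝ (EuclideanSpace ℝ (Fin n)) :=
  transSpan (((Subgroup.center G.N).map G.N.subtype).map G.Γ.subtype)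

theorem spanZ_le : G.spanZ ≤ G.V := by
  refine Submodule.span_mono ?_
  rintro a ⟨_, ⟨ν, _, rfl⟩, e⟩
  exact ⟨ν.1, ν.2, e⟩

/-- `Span(Z(N))` as a subspace of `V`. -/
def Z : Submodule ℝ G.V := G.spanZ.comap G.V.subtype

theorem lin_spanZ (ν : G.Γ) (hν : ν ∈ G.N) {v : EuclideanSpace ℝ (Fin n)} (hv : v ∈ G.spanZ) :
    linPart ν.1 v = v := by
  induction hv using Submodule.span_induction with
  | mem a ha =>
    obtain ⟨_, ⟨ζ, hζ, rfl⟩, e⟩ := ha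
    have e' : ζ.1.1 = transl a := e
    have h := congrArg (fun k : G.N => k.1.1 0) (Subgroup.mem_center_iff.1 hζ ⟨ν, hν⟩)
    have h' : ν.1 (ζ.1.1 0) = ζ.1.1 (ν.1 0) := h
    rw [e'] at h'
    have h2 : ν.1 (a + 0) = a + ν.1 0 := h'
    rw [add_zero, isom_apply ν.1 a, add_comm] at h2
    exact add_right_cancel h2
  | zero => simp
  | add x y _ _ hx hy => rw [map_add, hx, hy]
  | smul r x _ hx => rw [map_smul, hx]

theorem transl_mem_normalizer (v : G.Z) :
    transl v.1 ∈ Subgroup.normalizer (G.Nbar : Set (G.V ≃ᵃⁱ[ℝ] G.V)) := by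
  have key : ∀ a ∈ G.Nbar, a * transl v.1 = transl v.1 * a := by
    rintro _ ⟨ν, hν, rfl⟩
    ext1 x
    have h1 : restrictLin G.Γ G.V G.lin_mem_V ν v.1 = v.1 :=
      Subtype.ext (G.lin_spanZ ν hν v.2)
    change G.bar ν (v.1 + x) = v.1 + G.bar ν x
    rw [bar, restrictHom_apply, restrictHom_apply, map_add, h1, add_left_comm]
  refine Subgroup.mem_normalizer_iff.2 fun a => ⟨fun h => ?_, fun h => ?_⟩
  · rwa [← key a h, mul_inv_cancel_right]
  · have := key _ h
    rw [inv_mul_cancel_right, mul_assoc (transl v.1)] at this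
    rwa [mul_left_cancel this]

/-- The isometry `(v + Ī)_⋆` of `V/N`, for `v ∈ Span(Z(N))`. -/
def transStar (v : G.Z) : G.VmodN ≃ᵢ G.VmodN := starHom G.Nbar ⟨transl v.1, G.transl_mem_normalizer v⟩

/-- The connected component `𝒦` of the identity of `Isom(V/N)`. -/
def K : Subgroup (G.VmodN ≃ᵢ G.VmodN) := Subgroup.connectedComponentOfOne _

end SpaceGroupPair

end

/-!
Let `X = V/N` be the orbit space. The theorem has a geometric part, the description of the identity
component `𝒦` of `Isom(X)`, and an algebraic part, the equivalence of the three conditions.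

*The identity component.* The group `N̄` acts locally finitely on `V` (it inherits discreteness from
`Γ`), and its translations span `V`. The main point is that every isometry `χ` of `X` lifts to an
isometry of `V` (`ActsLocallyFinitely.exists_lift`). Local lifts are unique up to `N̄`: this is
Baire's theorem for the countably many closed sets on which two lifts differ by a given element of
`N̄`. Hence they can be continued along connected sets, and it suffices to lift `χ` near every point
`y`. If the stabiliser of `y` is trivial, `V → X` is a local isometry near `y`; such points are
recognised in `X` by the existence of antipodes, so `χ` preserves them, and a local isometry of
Euclidean space extends. In general one argues by induction on the order of the stabiliser: all
points near `y` off its fixed space have smaller stabilisers. If the fixed space has codimension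
at least two, its complement is connected. If it is a hyperplane, the stabiliser is
generated by the reflection in it, and comparing distances in the half ball on one side shows that
the reflection corresponds under the lift to another reflection in `N̄`.

A lift normalises `N̄`. If `χ` is close to the identity, the lift `f` can be taken close to the
identity, so `f` moves the vectors of a basis of the lattice, and the linear parts of `N̄` move the
translation vector of `f`, by short lattice vectors, which are zero. Thus `f` is the translation
by a vector fixed by the point group of `N̄`
(`ActsLocallyFinitely.eventually_exists_translation`). Averaging over the finite point group
shows that these vectors form `Span(Z(N))`. So the connected group of the `(v + Ī)_⋆` is open,
and equals `𝒦` (`SpaceGroupPair.K_eq_range`). The actions on `𝒦₁` and `𝒦₂` are by conjugation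
with `Ξ₁(g)` and `α_♯ Ξ₁(g)`.

*The equivalence.* An affinity `φ` as in condition (1) is `v + w ↦ α v + D w + β w`, and
`δ φ = φ γ` means that `δ' β = β γ'` and `δ̄ α = D b' + α γ̄`
(`SpaceGroupPair.intertwines_iff`). Condition (2) says that, for `δ` with `δ' = β γ' β⁻¹`, the two
sides of the last equation agree modulo `N̄₂` at every point. By the Baire argument they differ by one
element of `N̄₂`, which can be absorbed into `δ` (`SpaceGroupPair.conjugates_of_Xi_eq`).
Condition (3) is the image of (2) under `α_♯⁻¹`.
-/

noncomputable section

/-! ### Orbit spaces of locally finite groups of isometries -/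

section Lifting

variable {W : Type*} [NormedAddCommGroup W] [InnerProductSpace ℝ W]

/-- Only finitely many elements of `H` move the origin by at most `R`. For subgroups of the
isometry group of a Euclidean space this is equivalent to discreteness. -/
def ActsLocallyFinitely (H : Subgroup (W ≃ᵃⁱ[ℝ] W)) : Prop :=
  ∀ R : ℝ, {h : W ≃ᵃⁱ[ℝ] W | h ∈ H ∧ ‖h 0‖ ≤ R}.Finite

variable {H : Subgroup (W ≃ᵃⁱ[ℝ] W)}

theorem ActsLocallyFinitely.finite_dist_le (hH : ActsLocallyFinitely H) (x y : W) (R : ℝ) :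
    {h : W ≃ᵃⁱ[ℝ] W | h ∈ H ∧ dist x (h y) ≤ R}.Finite := by
  refine (hH (‖x‖ + R + ‖y‖)).subset ?_
  rintro h ⟨hh, hd⟩
  refine ⟨hh, ?_⟩
  have h1 : ‖h 0‖ = dist 0 (h 0) := by rw [dist_zero_left]
  have h2 := dist_triangle4 0 x (h y) (h 0)
  rw [h.dist_map, dist_zero_left x, dist_zero_right y, ← h1] at h2
  linarith

theorem ActsLocallyFinitely.countable (hH : ActsLocallyFinitely H) :
    (H : Set (W ≃ᵃⁱ[ℝ] W)).Countable := by
  have : (H : Set (W ≃ᵃⁱ[ℝ] W)) = ⋃ n : ℕ, {h | h ∈ H ∧ ‖h 0‖ ≤ n} := by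
    ext h
    simp only [Set.mem_iUnion, Set.mem_ofPred_eq, SetLike.mem_coe]
    exact ⟨fun hh => ⟨_, hh, (exists_nat_ge ‖h 0‖).choose_spec⟩, fun ⟨_, hh, _⟩ => hh⟩
  rw [this]
  exact Set.countable_iUnion fun n => (hH n).countable

theorem dist_orbitMk_le {h : W ≃ᵃⁱ[ℝ] W} (hh : h ∈ H) (x y : W) :
    dist (orbitMk H x) (orbitMk H y) ≤ dist x (h y) :=
  ciInf_le (orbit_bdd H x y) ⟨h, hh⟩

theorem dist_orbitMk_le_dist (x y : W) : dist (orbitMk H x) (orbitMk H y) ≤ dist x y :=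
  dist_orbitMk_le H.one_mem x y

theorem orbitMk_apply {h : W ≃ᵃⁱ[ℝ] W} (hh : h ∈ H) (x : W) : orbitMk H (h x) = orbitMk H x :=
  ((orbitMk_eq_iff H).2 ⟨h, hh, rfl⟩).symm

theorem exists_orbitMk_eq (p : OrbitSpace H) : ∃ x, orbitMk H x = p := Quotient.exists_rep p

theorem ActsLocallyFinitely.exists_dist_eq (hH : ActsLocallyFinitely H) (x y : W) :
    ∃ h ∈ H, dist (orbitMk H x) (orbitMk H y) = dist x (h y) := by
  obtain ⟨h, ⟨hh, _⟩, hmin⟩ := (hH.finite_dist_le x y (dist x y)).exists_minimalFor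
    (fun h => dist x (h y)) _ ⟨1, H.one_mem, le_rfl⟩
  refine ⟨h, hh, le_antisymm (dist_orbitMk_le hh x y) (le_ciInf fun k => ?_)⟩
  by_contra! hk
  have h1 : dist x (h y) ≤ dist x y := by assumption
  exact (hmin ⟨k.2, hk.le.trans h1⟩ hk.le).not_gt hk

theorem ActsLocallyFinitely.exists_rep_dist_eq (hH : ActsLocallyFinitely H) (x : W)
    (p : OrbitSpace H) :
    ∃ y, orbitMk H y = p ∧ dist x y = dist (orbitMk H x) p := by
  obtain ⟨y, rfl⟩ := exists_orbitMk_eq p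
  obtain ⟨h, hh, e⟩ := hH.exists_dist_eq x y
  exact ⟨h y, orbitMk_apply hh y, e.symm⟩

theorem ActsLocallyFinitely.eq_of_dist_eq_zero (hH : ActsLocallyFinitely H) {p q : OrbitSpace H}
    (h : dist p q = 0) : p = q := by
  obtain ⟨x, rfl⟩ := exists_orbitMk_eq p
  obtain ⟨y, rfl, e⟩ := hH.exists_rep_dist_eq x q
  rw [h] at e
  rw [dist_eq_zero.1 e]

theorem continuous_orbitMk : Continuous (orbitMk H) :=
  (LipschitzWith.of_dist_le_mul (K := 1) fun x y => by
    simpa using dist_orbitMk_le_dist (H := H) x y).continuous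

/-- Every point `y` has a radius `r` such that an element of `H` moving `y` by less than `4 r`
fixes `y`. -/
theorem ActsLocallyFinitely.exists_separation (hH : ActsLocallyFinitely H) (y : W) :
    ∃ r > 0, ∀ h ∈ H, dist y (h y) < 4 * r → h y = y := by
  have hf : {h : W ≃ᵃⁱ[ℝ] W | (h ∈ H ∧ dist y (h y) ≤ 1) ∧ h y ≠ y}.Finite :=
    (hH.finite_dist_le y y 1).subset fun h hh => hh.1
  rcases Set.eq_empty_or_nonempty
    {h : W ≃ᵃⁱ[ℝ] W | (h ∈ H ∧ dist y (h y) ≤ 1) ∧ h y ≠ y} with h0 | h0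
  · refine ⟨1 / 4, by norm_num, fun h hh hd => ?_⟩
    by_contra hne
    have : h ∈ {h : W ≃ᵃⁱ[ℝ] W | (h ∈ H ∧ dist y (h y) ≤ 1) ∧ h y ≠ y} :=
      ⟨⟨hh, by linarith⟩, hne⟩
    rw [h0] at this
    exact this
  · obtain ⟨k, hk, hmin⟩ := hf.exists_minimalFor (fun h => dist y (h y)) _ h0
    have hpos : 0 < dist y (k y) := dist_pos.2 (Ne.symm hk.2)
    refine ⟨dist y (k y) / 4, by linarith, fun h hh hd => ?_⟩
    by_contra hne
    have hlt : dist y (h y) < dist y (k y) := by linarith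
    exact (hmin (j := h) ⟨⟨hh, hlt.le.trans hk.1.2⟩, hne⟩ hlt.le).not_gt hlt

theorem fixes_of_dist_lt {y : W} {r : ℝ} (hr : ∀ h ∈ H, dist y (h y) < 4 * r → h y = y)
    {x x' : W} (hx : dist x y < r) (hx' : dist x' y < r) {h : W ≃ᵃⁱ[ℝ] W} (hh : h ∈ H)
    (hd : dist x (h x') < 2 * r) : h y = y := by
  refine hr h hh ?_
  have := dist_triangle4 y x (h x') (h y)
  rw [h.dist_map, dist_comm y x] at this
  linarith

/-- Within the separation radius, the orbit distance is realised by the stabiliser of `y`. -/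
theorem ActsLocallyFinitely.exists_stabilizer_dist_eq (hH : ActsLocallyFinitely H) {y : W} {r : ℝ}
    (hr : ∀ h ∈ H, dist y (h y) < 4 * r → h y = y)
    {x x' : W} (hx : dist x y < r) (hx' : dist x' y < r) :
    ∃ h ∈ H, h y = y ∧ dist (orbitMk H x) (orbitMk H x') = dist x (h x') := by
  obtain ⟨h, hh, e⟩ := hH.exists_dist_eq x x'
  refine ⟨h, hh, fixes_of_dist_lt hr hx hx' hh ?_, e⟩
  rw [← e]
  refine (dist_orbitMk_le_dist x x').trans_lt ((dist_triangle_right x x' y).trans_lt ?_)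
  linarith

theorem ActsLocallyFinitely.dist_eq_of_trivial_stabilizer (hH : ActsLocallyFinitely H) {y : W}
    {r : ℝ}
    (hr : ∀ h ∈ H, dist y (h y) < 4 * r → h y = y) (hy : ∀ h ∈ H, h y = y → h = 1)
    {x x' : W} (hx : dist x y < r) (hx' : dist x' y < r) :
    dist (orbitMk H x) (orbitMk H x') = dist x x' := by
  obtain ⟨h, hh, hs, e⟩ := hH.exists_stabilizer_dist_eq hr hx hx'
  rw [e, hy h hh hs]
  rfl

theorem ActsLocallyFinitely.dist_center_eq (hH : ActsLocallyFinitely H) {y : W} {r : ℝ}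
    (hr0 : 0 < r)
    (hr : ∀ h ∈ H, dist y (h y) < 4 * r → h y = y) {x : W} (hx : dist x y < r) :
    dist (orbitMk H y) (orbitMk H x) = dist y x := by
  obtain ⟨h, hh, hs, e⟩ := hH.exists_stabilizer_dist_eq hr (x := y) (by simpa using hr0) hx
  rw [e]
  conv_lhs => rw [← hs]
  exact h.dist_map y x

/-- If two affine maps have the same `H`-orbits of values on a nonempty open set, they differ by
an element of `H`: by Baire's theorem one of the countably many closed sets `{x | h (a x) = b x}`
has interior. -/
theorem ActsLocallyFinitely.exists_comp_eq [FiniteDimensional ℝ W] {U : Type*} [NormedAddCommGroup U]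
    [InnerProductSpace ℝ U] [FiniteDimensional ℝ U] (hH : ActsLocallyFinitely H) (a b : U →ᵃ[ℝ] W)
    {O : Set U} (hO : IsOpen O) (hne : O.Nonempty)
    (hab : ∀ x ∈ O, orbitMk H (a x) = orbitMk H (b x)) :
    ∃ h ∈ H, ∀ x, h (a x) = b x := by
  have hcl : ∀ h : W ≃ᵃⁱ[ℝ] W, IsClosed {x | h (a x) = b x} := fun h =>
    isClosed_eq (h.continuous.comp a.continuous_of_finiteDimensional)
      b.continuous_of_finiteDimensional
  by_contra! hcon
  have hd : Dense (⋂ h ∈ (H : Set (W ≃ᵃⁱ[ℝ] W)), {x | h (a x) = b x}ᶜ) := by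
    refine dense_biInter_of_isOpen (fun h _ => (hcl h).isOpen_compl) hH.countable fun h hh => ?_
    rw [← interior_eq_empty_iff_dense_compl]
    by_contra hi
    obtain ⟨x, hx⟩ := hcon h hh
    apply hx
    have : h.toAffineEquiv.toAffineMap.comp a = b :=
      AffineMap.ext_on (isOpen_interior.affineSpan_eq_top (Set.nonempty_iff_ne_empty.2 hi))
        fun x hx => (interior_subset hx : x ∈ {x | h (a x) = b x})
    exact DFunLike.congr_fun this x
  obtain ⟨x, hxO, hx⟩ := hd.inter_open_nonempty O hO hne
  obtain ⟨h, hh, e⟩ := (orbitMk_eq_iff H).1 (hab x hxO)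
  exact Set.mem_iInter₂.1 hx h hh e

/-! ### Points with trivial stabiliser -/

/-- Near `p`, every point has an antipode with respect to `p`. -/
def HasAntipodes {X : Type*} [PseudoMetricSpace X] (p : X) : Prop :=
  ∃ r > 0, ∀ q, dist p q < r → ∃ q', dist p q' = dist p q ∧ dist q q' = 2 * dist p q

theorem HasAntipodes.map {X Y : Type*} [PseudoMetricSpace X] [PseudoMetricSpace Y] (χ : X ≃ᵢ Y)
    {p : X} (h : HasAntipodes p) : HasAntipodes (χ p) := by
  obtain ⟨r, hr, h⟩ := h
  refine ⟨r, hr, fun q hq => ?_⟩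
  obtain ⟨q, rfl⟩ := χ.surjective q
  rw [χ.dist_eq] at hq
  obtain ⟨q', h1, h2⟩ := h q hq
  exact ⟨χ q', by rw [χ.dist_eq, χ.dist_eq, h1], by rw [χ.dist_eq, χ.dist_eq, h2]⟩

theorem ActsLocallyFinitely.hasAntipodes (hH : ActsLocallyFinitely H) {y : W}
    (hy : ∀ h ∈ H, h y = y → h = 1) : HasAntipodes (orbitMk H y) := by
  obtain ⟨r, hr0, hr⟩ := hH.exists_separation y
  refine ⟨r, hr0, fun q hq => ?_⟩
  obtain ⟨x, rfl, e⟩ := hH.exists_rep_dist_eq y q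
  have hx : dist x y < r := by rw [dist_comm, e]; exact hq
  have e1 : y - (y + (y - x)) = -(y - x) := by abel
  have e2 : x - (y + (y - x)) = -((2 : ℝ) • (y - x)) := by rw [two_smul]; abel
  have hx' : dist (y + (y - x)) y < r := by
    rw [dist_comm, dist_eq_norm, e1, norm_neg, ← dist_eq_norm, dist_comm]
    exact hx
  refine ⟨orbitMk H (y + (y - x)), ?_, ?_⟩
  · rw [hH.dist_center_eq hr0 hr hx', ← e, dist_eq_norm, e1, norm_neg, dist_eq_norm]
  · rw [hH.dist_eq_of_trivial_stabilizer hr hy hx hx', ← e, dist_eq_norm, e2, norm_neg, norm_smul,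
      dist_eq_norm]
    simp

/-- Equality in the triangle inequality: `z` is the reflection of `x` in `y`. -/
theorem eq_of_antipodal {x y z : W} {d : ℝ} (hx : dist y x = d) (hz : dist y z = d)
    (hxz : 2 * d ≤ dist x z) : z = y + (y - x) := by
  have hp := parallelogram_law_with_norm ℝ (y - x) (y - z)
  have e1 : y - x - (y - z) = -(x - z) := by abel
  rw [e1, norm_neg, ← dist_eq_norm, ← dist_eq_norm, ← dist_eq_norm, hx, hz] at hp
  have hd : 0 ≤ d := hx ▸ dist_nonneg
  have h0 : ‖y - x + (y - z)‖ = 0 := by nlinarith [norm_nonneg (y - x + (y - z))]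
  have := norm_eq_zero.1 h0
  rw [← sub_eq_zero, ← neg_eq_zero, ← this]
  abel

/-- If `h` fixes `y`, an antipode of the orbit of `x` with respect to that of `y` has a
representative antipodal both to `x` and to `h x`, so that `h x = x`. -/
theorem ActsLocallyFinitely.eq_one_of_hasAntipodes (hH : ActsLocallyFinitely H) {y : W}
    (ha : HasAntipodes (orbitMk H y)) {h : W ≃ᵃⁱ[ℝ] W} (hh : h ∈ H) (hy : h y = y) : h = 1 := by
  obtain ⟨ρ, hρ, ha⟩ := ha
  obtain ⟨r, hr0, hr⟩ := hH.exists_separation y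
  by_contra hne
  obtain ⟨u, hu⟩ : ∃ u, linPart h u ≠ u := by
    by_contra! hall
    refine hne (AffineIsometryEquiv.ext fun x => ?_)
    have := h.map_vadd y (x - y)
    simp only [vadd_eq_add, sub_add_cancel, hy, hall] at this
    exact this
  obtain ⟨t, ht0, ht⟩ : ∃ t : ℝ, 0 < t ∧ t * ‖u‖ < min ρ r := by
    refine ⟨min ρ r / (‖u‖ + 1), by positivity, ?_⟩
    rw [div_mul_eq_mul_div, div_lt_iff₀ (by positivity)]
    have : 0 < min ρ r := by positivity
    nlinarith
  have hd : dist y (y + t • u) = t * ‖u‖ := by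
    rw [dist_eq_norm, sub_add_cancel_left, norm_neg, norm_smul, Real.norm_of_nonneg ht0.le]
  have hxr : dist (y + t • u) y < r := by rw [dist_comm, hd]; exact ht.trans_le (min_le_right _ _)
  have hc := hH.dist_center_eq hr0 hr hxr
  obtain ⟨q', h1, h2⟩ := ha (orbitMk H (y + t • u))
    (by rw [hc, hd]; exact ht.trans_le (min_le_left _ _))
  obtain ⟨z, rfl, hz⟩ := hH.exists_rep_dist_eq y q'
  rw [h1, hc] at hz
  rw [hc] at h2
  have a1 := eq_of_antipodal rfl hz (h2 ▸ dist_orbitMk_le_dist _ _)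
  have hhx : dist y (h (y + t • u)) = dist y (y + t • u) := by
    have := h.dist_map y (y + t • u)
    rwa [hy] at this
  have a2 := eq_of_antipodal hhx hz (by
    rw [← h2, ← orbitMk_apply hh (y + t • u)]
    exact dist_orbitMk_le_dist _ _)
  have a3 : h (y + t • u) = y + t • u := by
    exact (sub_right_injective (add_left_cancel (a1.symm.trans a2))).symm
  have a4 := h.map_vadd y (t • u)
  simp only [vadd_eq_add, hy] at a4
  rw [add_comm (t • u) y, a3, add_comm, add_right_cancel_iff, map_smul] at a4
  exact hu (smul_right_injective W ht0.ne' a4.symm)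

end Lifting

section LocalLifts

variable {W : Type*} [NormedAddCommGroup W] [InnerProductSpace ℝ W]
variable {H : Subgroup (W ≃ᵃⁱ[ℝ] W)}

/-! ### Lifting isometries of an orbit space -/

theorem map_add_of_fixes {f : W ≃ᵃⁱ[ℝ] W} {y : W} (hy : f y = y) (u : W) :
    f (y + u) = y + linPart f u := by
  have := f.map_vadd y u
  simp only [vadd_eq_add, hy] at this
  rw [add_comm y, this, add_comm]

theorem map_of_fixes {f : W ≃ᵃⁱ[ℝ] W} {y : W} (hy : f y = y) (x : W) :
    f x = y + linPart f (x - y) := by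
  rw [← map_add_of_fixes hy, add_sub_cancel]

theorem eq_of_fixes {f g : W ≃ᵃⁱ[ℝ] W} {y : W} (hf : f y = y) (hg : g y = y)
    (h : ∀ u, linPart f u = linPart g u) : f = g :=
  AffineIsometryEquiv.ext fun x => by rw [map_of_fixes hf, map_of_fixes hg, h]

/-- A map of a ball into the space that preserves distances is the restriction of an isometry of
the whole space. -/
theorem exists_affineIsometryEquiv_of_dist_eq [FiniteDimensional ℝ W] {y : W} {r : ℝ} (hr : 0 < r)
    (F : W → W)
    (hF : ∀ x x', dist x y < r → dist x' y < r → dist (F x) (F x') = dist x x') :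
    ∃ f : W ≃ᵃⁱ[ℝ] W, ∀ x, dist x y < r → f x = F x := by
  set G : W → W := fun u => F (y + u) - F y with hG
  have hy : dist y y < r := by simpa using hr
  have hball : ∀ u : W, ‖u‖ < r → dist (y + u) y < r := fun u hu => by simpa [dist_eq_norm] using hu
  have hsub : ∀ u v : W, ‖u‖ < r → ‖v‖ < r → ‖G u - G v‖ = ‖u - v‖ := fun u v hu hv => by
    have := hF _ _ (hball u hu) (hball v hv)
    rw [dist_eq_norm, dist_eq_norm, add_sub_add_left_eq_sub] at this
    rw [← this, hG, sub_sub_sub_cancel_right]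
  have hnorm : ∀ u : W, ‖u‖ < r → ‖G u‖ = ‖u‖ := fun u hu => by
    have := hsub u 0 hu (by simpa using hr)
    simpa [hG] using this
  have hinner : ∀ u v : W, ‖u‖ < r → ‖v‖ < r → inner ℝ (G u) (G v) = inner ℝ u v := by
    intro u v hu hv
    rw [real_inner_eq_norm_mul_self_add_norm_mul_self_sub_norm_sub_mul_self_div_two,
      real_inner_eq_norm_mul_self_add_norm_mul_self_sub_norm_sub_mul_self_div_two,
      hsub u v hu hv, hnorm u hu, hnorm v hv]
  set b := stdOrthonormalBasis ℝ W
  have hρ : ∀ i, ‖(r / 2) • b i‖ < r := fun i => by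
    rw [norm_smul, b.norm_eq_one, mul_one, Real.norm_of_nonneg (by positivity)]
    linarith
  set e : Fin (Module.finrank ℝ W) → W := fun i => (r / 2)⁻¹ • G ((r / 2) • b i) with he
  have hinv : (r / 2)⁻¹ * (r / 2) = 1 := inv_mul_cancel₀ (by positivity)
  have heb : ∀ i u, ‖u‖ < r → inner ℝ (e i) (G u) = inner ℝ (b i) u := fun i u hu => by
    rw [he, real_inner_smul_left, hinner _ _ (hρ i) hu, real_inner_smul_left, ← mul_assoc, hinv,
      one_mul]
  have heo : Orthonormal ℝ e := by
    have : ∀ i j, inner ℝ (e i) (e j) = inner ℝ (b i) (b j) := fun i j => by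
      conv_lhs => rw [he]
      change inner ℝ (e i) ((r / 2)⁻¹ • G ((r / 2) • b j)) = _
      rw [real_inner_smul_right, heb i _ (hρ j), real_inner_smul_right, ← mul_assoc, hinv, one_mul]
    rw [orthonormal_iff_ite]
    intro i j
    rw [this]
    exact orthonormal_iff_ite.1 b.orthonormal i j
  have hcons : (b.toBasis.constr ℝ e : W →ₗ[ℝ] W) ∘ b.toBasis = e :=
    funext fun i => b.toBasis.constr_basis ℝ e i
  set A : W ≃ₗᵢ[ℝ] W := LinearIsometry.toLinearIsometryEquiv
    ((b.toBasis.constr ℝ e : W →ₗ[ℝ] W).isometryOfOrthonormal (v := b.toBasis)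
      (by simp) (by rw [hcons]; exact heo)) rfl
  have hAe : ∀ i, A (b i) = e i := fun i => by
    rw [← b.coe_toBasis]
    exact congrFun hcons i
  have hAG : ∀ u, ‖u‖ < r → A u = G u := fun u hu => by
    refine (b.map A).repr.injective (PiLp.ext fun i => ?_)
    rw [OrthonormalBasis.repr_apply_apply, OrthonormalBasis.repr_apply_apply,
      OrthonormalBasis.map_apply, A.inner_map_map, hAe, heb i u hu]
  refine ⟨AffineIsometryEquiv.mk' (fun x => A (x - y) + F y) A y (by intro x; simp), fun x hx => ?_⟩
  rw [AffineIsometryEquiv.coe_mk', hAG _ (by rwa [← dist_eq_norm]), hG]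
  simp

/-- The isometry `f` of `W` lifts the isometry `χ` of `W/H` near the point `y`. -/
def IsLiftAt (χ : OrbitSpace H ≃ᵢ OrbitSpace H) (f : W ≃ᵃⁱ[ℝ] W) (y : W) : Prop :=
  ∀ᶠ x in 𝓝 y, χ (orbitMk H x) = orbitMk H (f x)

variable {χ : OrbitSpace H ≃ᵢ OrbitSpace H}

theorem IsLiftAt.eq {f : W ≃ᵃⁱ[ℝ] W} {y : W} (h : IsLiftAt χ f y) :
    χ (orbitMk H y) = orbitMk H (f y) := h.self_of_nhds

theorem IsLiftAt.mul_left {f k : W ≃ᵃⁱ[ℝ] W} {y : W} (h : IsLiftAt χ f y) (hk : k ∈ H) :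
    IsLiftAt χ (k * f) y :=
  h.mono fun _ hx => hx.trans (orbitMk_apply hk _).symm

theorem ActsLocallyFinitely.isLiftAt_unique [FiniteDimensional ℝ W] (hH : ActsLocallyFinitely H)
    {f g : W ≃ᵃⁱ[ℝ] W} {y : W} (hf : IsLiftAt χ f y) (hg : IsLiftAt χ g y) :
    ∃ k ∈ H, g = k * f := by
  obtain ⟨O, hO, hOo, hy⟩ := eventually_nhds_iff.1 (hf.and hg)
  obtain ⟨k, hk, e⟩ := hH.exists_comp_eq f.toAffineEquiv.toAffineMap g.toAffineEquiv.toAffineMap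
    hOo ⟨y, hy⟩ fun x hx => (hO x hx).1.symm.trans (hO x hx).2
  exact ⟨k, hk, AffineIsometryEquiv.ext fun x => (e x).symm⟩

/-- By uniqueness up to `H`, a lift near one point of a connected open set all of whose points
have local lifts is a lift near every point of the set. -/
theorem ActsLocallyFinitely.isLiftAt_of_isPreconnected [FiniteDimensional ℝ W]
    (hH : ActsLocallyFinitely H) {O : Set W} (hO : IsPreconnected O)
    (hlift : ∀ x ∈ O, ∃ f, IsLiftAt χ f x) {f : W ≃ᵃⁱ[ℝ] W} {x₀ : W} (hx₀ : x₀ ∈ O)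
    (hf : IsLiftAt χ f x₀) : ∀ x ∈ O, IsLiftAt χ f x := by
  have ho : IsOpen {x | IsLiftAt χ f x} := isOpen_iff_mem_nhds.2 fun x hx =>
    eventually_eventually_nhds.2 hx
  have ho' : IsOpen {x | ∃ g, IsLiftAt χ g x ∧ ∀ k ∈ H, f ≠ k * g} := by
    refine isOpen_iff_mem_nhds.2 ?_
    rintro x ⟨g, hg, hne⟩
    filter_upwards [eventually_eventually_nhds.2 hg] with z hz
    exact ⟨g, hz, hne⟩
  refine hO.subset_left_of_subset_union (u := {x | IsLiftAt χ f x}) ho ho' ?_ ?_ ⟨x₀, hx₀, hf⟩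
  · refine Set.disjoint_left.2 ?_
    rintro x hx ⟨g, hg, hne⟩
    obtain ⟨k, hk, e⟩ := hH.isLiftAt_unique hg hx
    exact hne k hk e
  · intro x hx
    obtain ⟨g, hg⟩ := hlift x hx
    by_cases h : ∃ k ∈ H, f = k * g
    · obtain ⟨k, hk, rfl⟩ := h
      exact Or.inl (hg.mul_left hk)
    · push Not at h
      exact Or.inr ⟨g, hg, h⟩

theorem ActsLocallyFinitely.isClosed_setOf_lift (hH : ActsLocallyFinitely H) (f : W ≃ᵃⁱ[ℝ] W) :
    IsClosed {x | χ (orbitMk H x) = orbitMk H (f x)} := by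
  have : {x | χ (orbitMk H x) = orbitMk H (f x)} =
      {x | dist (χ (orbitMk H x)) (orbitMk H (f x)) = 0} := by
    ext x
    exact ⟨fun h => (congrArg (dist _) (Eq.symm h)).trans (dist_self _),
      fun h => hH.eq_of_dist_eq_zero h⟩
  rw [this]
  exact isClosed_eq ((χ.continuous.comp continuous_orbitMk).dist
    (continuous_orbitMk.comp f.continuous)) continuous_const

theorem ActsLocallyFinitely.trivial_stabilizer_map (hH : ActsLocallyFinitely H) {y z : W}
    (hyz : χ (orbitMk H y) = orbitMk H z) (hy : ∀ h ∈ H, h y = y → h = 1) :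
    ∀ h ∈ H, h z = z → h = 1 := fun _ hh hz =>
  hH.eq_one_of_hasAntipodes (hyz ▸ (hH.hasAntipodes hy).map χ) hh hz

/-- Near points with trivial stabiliser the orbit map is a local isometry, and `χ` preserves
the set of their orbits; so `χ` lifts there. -/
theorem ActsLocallyFinitely.exists_isLiftAt_of_trivial_stabilizer [FiniteDimensional ℝ W]
    (hH : ActsLocallyFinitely H) (χ : OrbitSpace H ≃ᵢ OrbitSpace H) {y : W}
    (hy : ∀ h ∈ H, h y = y → h = 1) : ∃ f, IsLiftAt χ f y := by
  obtain ⟨z, hz⟩ := exists_orbitMk_eq (χ (orbitMk H y))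
  have hz1 := hH.trivial_stabilizer_map hz.symm hy
  obtain ⟨r₁, hr₁, h₁⟩ := hH.exists_separation y
  obtain ⟨r₂, hr₂, h₂⟩ := hH.exists_separation z
  have hex : ∀ x, ∃ x', orbitMk H x' = χ (orbitMk H x) ∧ dist z x' =
      dist (orbitMk H y) (orbitMk H x) := fun x => by
    obtain ⟨x', e, hd⟩ := hH.exists_rep_dist_eq z (χ (orbitMk H x))
    exact ⟨x', e, by rw [hd, hz, χ.dist_eq]⟩
  choose F hF hFd using hex
  have hFr : ∀ x, dist x y < r₂ → dist (F x) z < r₂ := fun x hx => by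
    rw [dist_comm, hFd]
    exact (dist_orbitMk_le_dist _ _).trans_lt (by rwa [dist_comm])
  obtain ⟨f, hf⟩ := exists_affineIsometryEquiv_of_dist_eq (lt_min hr₁ hr₂) F
    (y := y) fun x x' hx hx' => by
      rw [lt_min_iff] at hx hx'
      rw [← hH.dist_eq_of_trivial_stabilizer h₂ hz1 (hFr x hx.2) (hFr x' hx'.2), hF, hF, χ.dist_eq,
        hH.dist_eq_of_trivial_stabilizer h₁ hy hx.1 hx'.1]
  refine ⟨f, ?_⟩
  filter_upwards [Metric.ball_mem_nhds y (lt_min hr₁ hr₂)] with x hx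
  rw [hf x hx, hF]

/-- The vectors fixed by the linear parts of the stabiliser of `y`. -/
def stabilizerFixed (H : Subgroup (W ≃ᵃⁱ[ℝ] W)) (y : W) : Submodule ℝ W where
  carrier := {u | ∀ h ∈ H, h y = y → linPart h u = u}
  add_mem' ha hb h hh hy := by rw [map_add, ha h hh hy, hb h hh hy]
  zero_mem' h _ _ := map_zero _
  smul_mem' c _ ha h hh hy := by rw [map_smul, ha h hh hy]

theorem trivial_stabilizer_of_fixed_eq_top {y : W} (h : stabilizerFixed H y = ⊤) :
    ∀ h ∈ H, h y = y → h = 1 := by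
  intro k hk hy
  refine eq_of_fixes hy rfl fun u => ?_
  have hu : u ∈ stabilizerFixed H y := h ▸ Submodule.mem_top
  exact hu k hk hy

theorem ball_subset_closure_compl [FiniteDimensional ℝ W] {F : Submodule ℝ W} (hF : F ≠ ⊤)
    (y : W) (r : ℝ) : Metric.ball y r ⊆ closure {x | x ∈ Metric.ball y r ∧ x - y ∉ F} := by
  have hd : Dense ((F : Set W)ᶜ) := by
    rw [← interior_eq_empty_iff_dense_compl]
    by_contra hi
    exact hF (F.eq_top_of_nonempty_interior' (Set.nonempty_iff_ne_empty.2 hi))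
  have hd' : Dense {x | x - y ∉ F} :=
    hd.preimage (f := fun x => x - y) (Homeomorph.subRight y).isOpenMap
  exact hd'.open_subset_closure_inter Metric.isOpen_ball

/-- A ball minus a subspace through its center of codimension at least two is connected: it is a
continuous image of the complement of the subspace. -/
theorem isPreconnected_ball_diff {F : Submodule ℝ W} (hF : 1 < Module.rank ℝ (W ⧸ F))
    (y : W) {r : ℝ} (hr : 0 < r) : IsPreconnected {x | x ∈ Metric.ball y r ∧ x - y ∉ F} := by
  have himg : {x | x ∈ Metric.ball y r ∧ x - y ∉ F} =
      (fun u : W => y + (r / (1 + ‖u‖)) • u) '' ((F : Set W)ᶜ) := by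
    ext x
    constructor
    · rintro ⟨hx, hxF⟩
      rw [Metric.mem_ball, dist_eq_norm] at hx
      have hpos : 0 < r - ‖x - y‖ := by linarith
      refine ⟨(r - ‖x - y‖)⁻¹ • (x - y), fun h => hxF ?_, ?_⟩
      · exact (F.smul_mem_iff (inv_pos.2 hpos).ne').1 h
      · change y + (r / (1 + ‖(r - ‖x - y‖)⁻¹ • (x - y)‖)) • ((r - ‖x - y‖)⁻¹ • (x - y)) = x
        rw [norm_smul, smul_smul, Real.norm_of_nonneg (inv_pos.2 hpos).le]
        have : r / (1 + (r - ‖x - y‖)⁻¹ * ‖x - y‖) * (r - ‖x - y‖)⁻¹ = 1 := by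
          have h1 : 1 + (r - ‖x - y‖)⁻¹ * ‖x - y‖ = r * (r - ‖x - y‖)⁻¹ := by
            field_simp
            ring
          rw [h1]
          field_simp
        rw [this, one_smul, add_sub_cancel]
    · rintro ⟨u, hu, rfl⟩
      have hpos : 0 < 1 + ‖u‖ := by positivity
      refine ⟨?_, fun h => hu ?_⟩
      · rw [Metric.mem_ball, dist_eq_norm, add_sub_cancel_left, norm_smul,
          Real.norm_of_nonneg (by positivity), div_mul_eq_mul_div, div_lt_iff₀ hpos]
        nlinarith [norm_nonneg u]
      · rw [add_sub_cancel_left] at h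
        exact (F.smul_mem_iff (div_pos hr hpos).ne').1 h
  rw [himg]
  refine (isConnected_compl_of_one_lt_codim hF).isPreconnected.image _ (Continuous.continuousOn ?_)
  have : ∀ u : W, 1 + ‖u‖ ≠ 0 := fun u => by positivity
  fun_prop (disch := assumption)

end LocalLifts

section GlobalLift

variable {W : Type*} [NormedAddCommGroup W] [InnerProductSpace ℝ W]
variable {H : Subgroup (W ≃ᵃⁱ[ℝ] W)} {χ : OrbitSpace H ≃ᵢ OrbitSpace H}

theorem dist_add_left_eq {M : Type*} [SeminormedAddCommGroup M] (y u v : M) :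
    dist (y + u) (y + v) = ‖u - v‖ := by
  rw [dist_eq_norm, add_sub_add_left_eq_sub]

/-- A linear isometry fixing a hyperplane pointwise is the identity or the reflection in it. -/
theorem eq_one_or_reflection {n : W} (hn : ‖n‖ = 1) {T : W ≃ₗᵢ[ℝ] W}
    (hT : ∀ u, inner ℝ n u = 0 → T u = u) :
    (∀ u, T u = u) ∨ ∀ u, T u = u - (2 * inner ℝ n u) • n := by
  have hnn : inner ℝ n n = (1 : ℝ) := by rw [real_inner_self_eq_norm_sq, hn, one_pow]
  have hdec : ∀ u, inner ℝ n (u - (inner ℝ n u : ℝ) • n) = 0 := fun u => by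
    rw [inner_sub_right, real_inner_smul_right, hnn, mul_one, sub_self]
  have hTu : ∀ u, T u = u - (inner ℝ n u : ℝ) • n + (inner ℝ n u : ℝ) • T n := fun u => by
    conv_lhs => rw [← sub_add_cancel u ((inner ℝ n u : ℝ) • n)]
    rw [map_add, hT _ (hdec u), map_smul]
  have hTn : T n = (inner ℝ n (T n) : ℝ) • n := by
    have h0 : inner ℝ (T n - (inner ℝ n (T n) : ℝ) • n) (T n - (inner ℝ n (T n) : ℝ) • n) =
        (0 : ℝ) := by
      set w := T n - (inner ℝ n (T n) : ℝ) • n with hw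
      have h1 : inner ℝ n w = (0 : ℝ) := hdec (T n)
      have h2 : inner ℝ (T n) w = (0 : ℝ) := by
        conv_lhs => rw [← hT w h1]
        rw [T.inner_map_map, h1]
      conv_lhs => enter [2]; rw [hw]
      rw [inner_sub_left, real_inner_smul_left, h1, h2]
      simp
    exact sub_eq_zero.1 (inner_self_eq_zero.1 h0)
  set c : ℝ := inner ℝ n (T n)
  have hc : |c| = 1 := by
    have := T.norm_map n
    rw [hTn, norm_smul, hn, mul_one] at this
    exact this
  rcases eq_or_eq_neg_of_abs_eq hc with h | h
  · left
    intro u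
    rw [hTu, hTn, h, one_smul, sub_add_cancel]
  · right
    intro u
    rw [hTu, hTn, h, mul_smul, two_smul]
    module

/-- A linear isometry `T` that does not decrease inner products of pairs of vectors of an open
half space fixes the bounding hyperplane pointwise. -/
theorem fixes_hyperplane_of_inner_le {n : W} {T : W ≃ₗᵢ[ℝ] W}
    (hn : ‖n‖ = 1)
    (hT : ∀ u v : W, 0 < (inner ℝ n u : ℝ) → 0 < (inner ℝ n v : ℝ) →
      (inner ℝ u (T v) : ℝ) ≤ inner ℝ u v) {w : W} (hw : inner ℝ n w = (0 : ℝ)) : T w = w := by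
  have hnn : inner ℝ n n = (1 : ℝ) := by rw [real_inner_self_eq_norm_sq, hn, one_pow]
  have hcl : ∀ u v : W, 0 ≤ (inner ℝ n u : ℝ) → 0 ≤ (inner ℝ n v : ℝ) →
      (inner ℝ u (T v) : ℝ) ≤ inner ℝ u v := by
    intro u v hu hv
    have hc : Continuous fun ε : ℝ =>
        (inner ℝ (u + ε • n) (v + ε • n) - inner ℝ (u + ε • n) (T (v + ε • n)) : ℝ) := by
      fun_prop
    have hlim := (hc.tendsto 0).mono_left (nhdsWithin_le_nhds (s := Set.Ioi 0))
    have := ge_of_tendsto (b := 0) hlim (by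
      filter_upwards [self_mem_nhdsWithin] with ε hε
      have hε : 0 < ε := hε
      exact sub_nonneg.2 (hT _ _
        (by rw [inner_add_right, real_inner_smul_right, hnn]; linarith)
        (by rw [inner_add_right, real_inner_smul_right, hnn]; linarith)))
    simp only [zero_smul, add_zero] at this
    linarith
  have hw' : inner ℝ n (-w) = (0 : ℝ) := by rw [inner_neg_right, hw, neg_zero]
  have hnonneg : ∀ v : W, 0 ≤ (inner ℝ n v : ℝ) → inner ℝ v (T w - w) = (0 : ℝ) := by
    intro v hv
    have h1 := hcl v w hv hw.ge
    have h2 := hcl v (-w) hv hw'.ge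
    rw [map_neg, inner_neg_right, inner_neg_right] at h2
    rw [inner_sub_right]
    linarith
  refine sub_eq_zero.1 (inner_self_eq_zero (𝕜 := ℝ).1 ?_)
  rcases le_total 0 (inner ℝ n (T w - w) : ℝ) with h | h
  · exact hnonneg _ h
  · have := hnonneg (-(T w - w)) (by rw [inner_neg_right]; linarith)
    rwa [inner_neg_left, neg_eq_zero] at this

/-- A proper subspace whose codimension is at most one is the orthogonal complement of a unit
vector. -/
theorem exists_unit_normal [FiniteDimensional ℝ W] {F : Submodule ℝ W} (hF : F ≠ ⊤)
    (hc : ¬ 1 < Module.rank ℝ (W ⧸ F)) :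
    ∃ n : W, ‖n‖ = 1 ∧ ∀ u, u ∈ F ↔ inner ℝ n u = (0 : ℝ) := by
  have hne : Fᗮ ≠ ⊥ := fun h => hF (F.orthogonal_eq_bot_iff.1 h)
  obtain ⟨m, hm, hm0⟩ := Submodule.exists_mem_ne_zero_of_ne_bot hne
  have hrank : Module.finrank ℝ Fᗮ ≤ 1 := by
    have h1 := F.finrank_add_finrank_orthogonal
    have h2 := F.finrank_quotient_add_finrank
    rw [← Module.finrank_eq_rank, not_lt] at hc
    have hc : Module.finrank ℝ (W ⧸ F) ≤ 1 := by exact_mod_cast hc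
    lia
  have hspan : ℝ ∙ m = Fᗮ := Submodule.eq_of_le_of_finrank_le
    ((Submodule.span_singleton_le_iff_mem _ _).2 hm) (by rwa [finrank_span_singleton hm0])
  refine ⟨‖m‖⁻¹ • m, norm_smul_inv_norm hm0, fun u => ?_⟩
  rw [real_inner_smul_left, mul_eq_zero_iff_left (inv_ne_zero (norm_ne_zero_iff.2 hm0)),
    ← Submodule.mem_orthogonal_singleton_iff_inner_right, hspan, F.orthogonal_orthogonal]

/-- The lifting step across a mirror: if the stabiliser of `y` is generated by a reflection, a
lift on one side of the mirror extends to a neighbourhood of `y`. The image of `y` has a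
nontrivial stabiliser, any element of which is the conjugate of the reflection because the
half ball at `y` embeds isometrically into the orbit space. -/
theorem ActsLocallyFinitely.lift_across_mirror (hH : ActsLocallyFinitely H) {y : W} {r : ℝ}
    (hr0 : 0 < r) (hr : ∀ h ∈ H, dist y (h y) < 4 * r → h y = y) {n : W} (hn : ‖n‖ = 1)
    (hF : ∀ u, u ∈ stabilizerFixed H y ↔ inner ℝ n u = (0 : ℝ)) {f : W ≃ᵃⁱ[ℝ] W}
    (hf : ∀ x, dist x y < r → 0 < (inner ℝ n (x - y) : ℝ) →
      χ (orbitMk H x) = orbitMk H (f x)) :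
    ∀ x, dist x y < r → x - y ∉ stabilizerFixed H y → χ (orbitMk H x) = orbitMk H (f x) := by
  have hnn : inner ℝ n n = (1 : ℝ) := by rw [real_inner_self_eq_norm_sq, hn, one_pow]
  have hrefl : ∀ h ∈ H, h y = y → h ≠ 1 →
      ∀ u, linPart h u = u - (2 * inner ℝ n u : ℝ) • n := by
    intro h hh hy hne
    refine (eq_one_or_reflection hn fun u hu => (hF u).2 hu h hh hy).resolve_left fun h1 => ?_
    exact hne (eq_of_fixes hy rfl h1)
  obtain ⟨s, hs, hsy, hs1⟩ : ∃ s ∈ H, s y = y ∧ s ≠ 1 := by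
    by_contra! hall
    have : n ∈ stabilizerFixed H y := fun h hh hy => by rw [hall h hh hy]; rfl
    rw [hF, hnn] at this
    exact one_ne_zero this
  -- `y` is a limit of points of the half ball
  have hfy : χ (orbitMk H y) = orbitMk H (f y) := by
    have hlim : Tendsto (fun t : ℝ => y + t • n) (𝓝[>] 0) (𝓝 y) := by
      have hc : Continuous fun t : ℝ => y + t • n := by fun_prop
      simpa using (hc.tendsto 0).mono_left (nhdsWithin_le_nhds (s := Set.Ioi 0))
    refine (hH.isClosed_setOf_lift (χ := χ) f).mem_of_tendsto hlim ?_
    filter_upwards [hlim (Metric.ball_mem_nhds y hr0), self_mem_nhdsWithin] with t ht ht0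
    refine hf _ ht ?_
    rw [add_sub_cancel_left, real_inner_smul_right, hnn, mul_one]
    exact ht0
  obtain ⟨τ, hτ, hτy, hτ1⟩ : ∃ τ ∈ H, τ (f y) = f y ∧ τ ≠ 1 := by
    by_contra! hall
    refine hs1 (hH.trivial_stabilizer_map (χ := χ.symm) (y := f y) ?_ hall s hs hsy)
    rw [← hfy, χ.symm_apply_apply]
  -- the half ball embeds isometrically into the orbit space
  have hhalf : ∀ u v : W, ‖u‖ < r → ‖v‖ < r → 0 < (inner ℝ n u : ℝ) → 0 < (inner ℝ n v : ℝ) →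
      dist (orbitMk H (y + u)) (orbitMk H (y + v)) = ‖u - v‖ := by
    intro u v hu hv hnu hnv
    refine le_antisymm ((dist_orbitMk_le_dist _ _).trans (dist_add_left_eq y u v).le) ?_
    obtain ⟨h, hh, hhy, e⟩ := hH.exists_stabilizer_dist_eq hr (x := y + u) (x' := y + v)
      (by simpa [dist_eq_norm] using hu) (by simpa [dist_eq_norm] using hv)
    rw [e, map_add_of_fixes hhy, dist_add_left_eq]
    by_cases h1 : h = 1
    · rw [h1]
      exact le_rfl
    · rw [hrefl h hh hhy h1]
      refine le_of_sq_le_sq ?_ (norm_nonneg _)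
      have e1 : u - (v - (2 * inner ℝ n v : ℝ) • n) = (u - v) + (2 * inner ℝ n v : ℝ) • n := by abel
      rw [e1, norm_add_sq_real, norm_smul, hn, real_inner_smul_right, inner_sub_left,
        real_inner_comm n u, real_inner_comm n v, mul_one, Real.norm_eq_abs, sq_abs]
      nlinarith [mul_pos hnu hnv]
  set τ' := f⁻¹ * τ * f with hτ'
  have hτ'y : τ' y = y := by
    change f.symm (τ (f y)) = y
    rw [hτy, f.symm_apply_apply]
  have hfτ : ∀ x, f (τ' x) = τ (f x) := fun x => f.apply_symm_apply _
  have hsmall : ∀ u v : W, ‖u‖ < r → ‖v‖ < r → 0 < (inner ℝ n u : ℝ) → 0 < (inner ℝ n v : ℝ) →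
      (inner ℝ u (linPart τ' v) : ℝ) ≤ inner ℝ u v := by
    intro u v hu hv hnu hnv
    have h1 : ‖u - v‖ ≤ ‖u - linPart τ' v‖ := by
      rw [← hhalf u v hu hv hnu hnv, ← χ.dist_eq,
        hf (y + u) (by simpa [dist_eq_norm] using hu) (by simpa using hnu),
        hf (y + v) (by simpa [dist_eq_norm] using hv) (by simpa using hnv)]
      refine (dist_orbitMk_le hτ _ _).trans ?_
      rw [← hfτ, f.dist_map, map_add_of_fixes hτ'y, dist_add_left_eq]
    have h2 : ‖u - v‖ ^ 2 ≤ ‖u - linPart τ' v‖ ^ 2 := by gcongr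
    rw [norm_sub_sq_real, norm_sub_sq_real, LinearIsometryEquiv.norm_map] at h2
    linarith
  have hscale : ∀ u : W, ∃ t : ℝ, 0 < t ∧ ‖t • u‖ < r := fun u => by
    refine ⟨r / (‖u‖ + 1), by positivity, ?_⟩
    rw [norm_smul, Real.norm_of_nonneg (by positivity), div_mul_eq_mul_div,
      div_lt_iff₀ (by positivity)]
    nlinarith [norm_nonneg u]
  have hall : ∀ u v : W, 0 < (inner ℝ n u : ℝ) → 0 < (inner ℝ n v : ℝ) →
      (inner ℝ u (linPart τ' v) : ℝ) ≤ inner ℝ u v := by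
    intro u v hnu hnv
    obtain ⟨a, ha, hua⟩ := hscale u
    obtain ⟨b, hb, hvb⟩ := hscale v
    have := hsmall (a • u) (b • v) hua hvb (by rw [real_inner_smul_right]; positivity)
      (by rw [real_inner_smul_right]; positivity)
    rw [map_smul, real_inner_smul_left, real_inner_smul_left, real_inner_smul_right,
      real_inner_smul_right] at this
    exact le_of_mul_le_mul_left (le_of_mul_le_mul_left this ha) hb
  have hτs : τ' = s := by
    refine eq_of_fixes hτ'y hsy fun u => ?_
    rw [hrefl s hs hsy hs1]
    refine (eq_one_or_reflection hn fun w hw =>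
      fixes_hyperplane_of_inner_le hn hall hw).resolve_left (fun h1 => hτ1 ?_) u
    have h2 : τ' = 1 := eq_of_fixes hτ'y rfl h1
    have h3 : τ = f * τ' * f⁻¹ := by rw [hτ']; group
    rw [h3, h2]
    group
  intro x hx hxF
  rw [hF] at hxF
  rcases lt_or_gt_of_ne hxF with h | h
  · have hsx := map_of_fixes hsy x
    rw [← orbitMk_apply hs x, ← orbitMk_apply hτ (f x), ← hfτ, hτs]
    refine hf _ ?_ ?_
    · have := s.dist_map x y
      rw [hsy] at this
      rwa [this]
    · rw [hsx, add_sub_cancel_left, hrefl s hs hsy hs1, inner_sub_right, real_inner_smul_right, hnn]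
      linarith
  · exact hf x hx h

/-- Every isometry of the orbit space lifts near every point. By induction on the order of the
stabiliser of `y`, there are lifts near all points close to `y` outside the fixed space of the
stabiliser. They are restrictions of one isometry if the complement of the fixed space is
connected, and otherwise the fixed space is a mirror. -/
theorem ActsLocallyFinitely.exists_isLiftAt [FiniteDimensional ℝ W]
    (hH : ActsLocallyFinitely H) (χ : OrbitSpace H ≃ᵢ OrbitSpace H) (y : W) : ∃ f, IsLiftAt χ f y := by
  induction hcard : {h : W ≃ᵃⁱ[ℝ] W | h ∈ H ∧ h y = y}.ncard using Nat.strong_induction_on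
    generalizing y with
  | _ m ih =>
    by_cases htop : stabilizerFixed H y = ⊤
    · exact hH.exists_isLiftAt_of_trivial_stabilizer χ (trivial_stabilizer_of_fixed_eq_top htop)
    obtain ⟨r, hr0, hr⟩ := hH.exists_separation y
    have hlift : ∀ x, dist x y < r → x - y ∉ stabilizerFixed H y → ∃ f, IsLiftAt χ f x := by
      intro x hx hxF
      refine ih _ ?_ x rfl
      rw [← hcard]
      refine Set.ncard_lt_ncard ⟨?_, fun hsub => hxF fun h hh hy => ?_⟩
        ((hH.finite_dist_le y y 0).subset fun h hh => ⟨hh.1, by rw [hh.2, dist_self]⟩)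
      · rintro h ⟨hh, hhx⟩
        exact ⟨hh, fixes_of_dist_lt hr hx hx hh (by rw [hhx, dist_self]; linarith)⟩
      · have h1 : h x = x := (hsub ⟨hh, hy⟩).2
        rw [map_of_fixes hy] at h1
        exact eq_sub_of_add_eq' h1
    -- a lift off the fixed space is a lift by continuity
    suffices h : ∃ f : W ≃ᵃⁱ[ℝ] W, ∀ x, dist x y < r → x - y ∉ stabilizerFixed H y →
        χ (orbitMk H x) = orbitMk H (f x) by
      obtain ⟨f, hf⟩ := h
      refine ⟨f, ?_⟩
      filter_upwards [Metric.ball_mem_nhds y hr0] with x hx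
      exact closure_minimal (fun z hz => hf z hz.1 hz.2) (hH.isClosed_setOf_lift f)
        (ball_subset_closure_compl htop y r hx)
    by_cases hcodim : 1 < Module.rank ℝ (W ⧸ stabilizerFixed H y)
    · obtain ⟨x₀, hx₀⟩ : {x | x ∈ Metric.ball y r ∧ x - y ∉ stabilizerFixed H y}.Nonempty :=
        closure_nonempty_iff.1 ⟨y, ball_subset_closure_compl htop y r (Metric.mem_ball_self hr0)⟩
      obtain ⟨f, hf⟩ := hlift x₀ hx₀.1 hx₀.2
      exact ⟨f, fun x hx hxF => (hH.isLiftAt_of_isPreconnected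
        (isPreconnected_ball_diff hcodim y hr0) (fun x hx => hlift x hx.1 hx.2) hx₀ hf x
        ⟨hx, hxF⟩).eq⟩
    · obtain ⟨n, hn, hF⟩ := exists_unit_normal htop hcodim
      have hnn : inner ℝ n n = (1 : ℝ) := by rw [real_inner_self_eq_norm_sq, hn, one_pow]
      have hconv : Convex ℝ {x | x ∈ Metric.ball y r ∧ 0 < (inner ℝ n (x - y) : ℝ)} := by
        refine (convex_ball y r).inter ?_
        intro a ha b hb s t hs ht hst
        have ha : 0 < (inner ℝ n (a - y) : ℝ) := ha
        have hb : 0 < (inner ℝ n (b - y) : ℝ) := hb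
        change 0 < (inner ℝ n (s • a + t • b - y) : ℝ)
        have e : s • a + t • b - y = s • (a - y) + t • (b - y) := by
          rw [smul_sub, smul_sub, sub_add_sub_comm, ← add_smul, hst, one_smul]
        rw [e, inner_add_right, real_inner_smul_right, real_inner_smul_right]
        rcases hs.eq_or_lt with rfl | hs
        · rw [zero_add] at hst
          rw [hst]
          linarith
        · positivity
      have hsub : ∀ x, x ∈ Metric.ball y r ∧ 0 < (inner ℝ n (x - y) : ℝ) → ∃ f, IsLiftAt χ f x :=
        fun x hx => hlift x hx.1 fun h => hx.2.ne' ((hF _).1 h)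
      have hx₀ : y + (r / 2) • n ∈ Metric.ball y r ∧
          0 < (inner ℝ n (y + (r / 2) • n - y) : ℝ) := by
        rw [Metric.mem_ball, dist_eq_norm, add_sub_cancel_left, norm_smul, hn, mul_one,
          Real.norm_of_nonneg (by positivity), real_inner_smul_right, hnn]
        constructor <;> linarith
      obtain ⟨f, hf⟩ := hsub _ hx₀
      exact ⟨f, hH.lift_across_mirror hr0 hr hn hF fun x hx hxn =>
        (hH.isLiftAt_of_isPreconnected hconv.isPreconnected hsub hx₀ hf x ⟨hx, hxn⟩).eq⟩

/-- Every isometry of `W/H` is induced by an isometry of `W`. -/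
theorem ActsLocallyFinitely.exists_lift [FiniteDimensional ℝ W]
    (hH : ActsLocallyFinitely H) (χ : OrbitSpace H ≃ᵢ OrbitSpace H) :
    ∃ f : W ≃ᵃⁱ[ℝ] W, ∀ x, χ (orbitMk H x) = orbitMk H (f x) := by
  obtain ⟨f, hf⟩ := hH.exists_isLiftAt χ 0
  exact ⟨f, fun x => (hH.isLiftAt_of_isPreconnected isPreconnected_univ
    (fun x _ => hH.exists_isLiftAt χ x) (Set.mem_univ 0) hf x (Set.mem_univ x)).eq⟩

/-- A lift of an isometry of `W/H` conjugates `H` into itself. -/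
theorem ActsLocallyFinitely.conj_mem_of_lift [FiniteDimensional ℝ W]
    (hH : ActsLocallyFinitely H) {f : W ≃ᵃⁱ[ℝ] W}
    (hf : ∀ x, χ (orbitMk H x) = orbitMk H (f x)) {h : W ≃ᵃⁱ[ℝ] W} (hh : h ∈ H) :
    f * h * f⁻¹ ∈ H := by
  obtain ⟨k, hk, e⟩ := hH.isLiftAt_unique (χ := χ) (f := f) (g := f * h) (y := 0)
    (Eventually.of_forall hf)
    (Eventually.of_forall fun x => by rw [← orbitMk_apply hh x]; exact hf (h x))
  rwa [e, mul_inv_cancel_right]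

end GlobalLift

section CrystallographicGroups

variable {W : Type*} [NormedAddCommGroup W] [InnerProductSpace ℝ W]
variable {H : Subgroup (W ≃ᵃⁱ[ℝ] W)}

/-! ### Groups with a spanning set of translations -/

theorem transl_zero : transl (0 : W) = 1 := by
  ext1 x
  exact zero_add x

theorem transl_mul (a b : W) : transl a * transl b = transl (a + b) := by
  ext1 x
  exact (add_assoc a b x).symm

theorem transl_inv (a : W) : (transl a)⁻¹ = transl (-a) :=
  inv_eq_of_mul_eq_one_right (by rw [transl_mul, add_neg_cancel, transl_zero])

/-- The subgroup of all `a` such that `a + I` is in `H`. -/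
def translationLattice (H : Subgroup (W ≃ᵃⁱ[ℝ] W)) : AddSubgroup W where
  carrier := {a | transl a ∈ H}
  add_mem' ha hb := by
    rw [Set.mem_ofPred_eq, ← transl_mul]
    exact H.mul_mem ha hb
  zero_mem' := by
    rw [Set.mem_ofPred_eq, transl_zero]
    exact H.one_mem
  neg_mem' ha := by
    rw [Set.mem_ofPred_eq, ← transl_inv]
    exact H.inv_mem ha

theorem mem_translationLattice {a : W} : a ∈ translationLattice H ↔ transl a ∈ H := Iff.rfl

theorem linPart_mem_translationLattice {f : W ≃ᵃⁱ[ℝ] W} (hf : ∀ h ∈ H, f * h * f⁻¹ ∈ H) {a : W}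
    (ha : a ∈ translationLattice H) : linPart f a ∈ translationLattice H := by
  rw [mem_translationLattice, ← conj_transl]
  exact hf _ ha

theorem linPart_eq_of_basis {ι : Type*} (b : Module.Basis ι ℝ W) {T T' : W ≃ₗᵢ[ℝ] W}
    (h : ∀ i, T (b i) = T' (b i)) : T = T' := by
  have : T.toLinearEquiv.toLinearMap = T'.toLinearEquiv.toLinearMap := b.ext h
  exact LinearIsometryEquiv.ext fun u => DFunLike.congr_fun this u

/-- The homomorphism taking an isometry to its linear part. -/
def linPartHom : (W ≃ᵃⁱ[ℝ] W) →* (W ≃ₗᵢ[ℝ] W) where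
  toFun := linPart
  map_one' := rfl
  map_mul' _ _ := rfl

theorem ActsLocallyFinitely.exists_lattice_separation (hH : ActsLocallyFinitely H) :
    ∃ δ > 0, ∀ a ∈ translationLattice H, ‖a‖ < δ → a = 0 := by
  obtain ⟨r, hr0, hr⟩ := hH.exists_separation 0
  refine ⟨4 * r, by positivity, fun a ha hlt => ?_⟩
  have e : transl a (0 : W) = a := add_zero a
  rw [← e]
  exact hr _ ha (by rwa [e, dist_zero_left])

variable [FiniteDimensional ℝ W]

theorem ActsLocallyFinitely.exists_trivial_stabilizer (hH : ActsLocallyFinitely H) :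
    ∃ x : W, ∀ h ∈ H, h x = x → h = 1 := by
  have hd : Dense (⋂ h ∈ {h | h ∈ H ∧ h ≠ 1}, {x : W | h x = x}ᶜ) := by
    refine dense_biInter_of_isOpen
      (fun h _ => (isClosed_eq h.continuous continuous_id).isOpen_compl)
      (hH.countable.mono fun h hh => hh.1) fun h hh => ?_
    rw [← interior_eq_empty_iff_dense_compl]
    by_contra hi
    refine hh.2 (AffineIsometryEquiv.ext fun x => ?_)
    have : h.toAffineEquiv.toAffineMap = AffineMap.id ℝ W :=
      AffineMap.ext_on (isOpen_interior.affineSpan_eq_top (Set.nonempty_iff_ne_empty.2 hi))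
        fun x hx => (interior_subset hx : x ∈ {x | h x = x})
    exact DFunLike.congr_fun this x
  obtain ⟨x, hx⟩ := hd.nonempty
  refine ⟨x, fun h hh hhx => ?_⟩
  by_contra hne
  exact Set.mem_iInter₂.1 hx h ⟨hh, hne⟩ hhx

theorem exists_basis_of_transSpan_eq_top (hspan : transSpan H = ⊤) :
    ∃ b : Module.Basis (Fin (Module.finrank ℝ W)) ℝ W, ∀ i, b i ∈ translationLattice H := by
  have hs : ⊤ ≤ Submodule.span ℝ {a : W | transl a ∈ H} := hspan.ge
  let b₀ := Module.Basis.ofSpan hs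
  have : Fintype ((linearIndepOn_empty ℝ id).extend (Set.empty_subset {a : W | transl a ∈ H})) :=
    FiniteDimensional.fintypeBasisIndex b₀
  refine ⟨b₀.reindex (Fintype.equivFinOfCardEq (Module.finrank_eq_card_basis b₀).symm),
    fun i => ?_⟩
  rw [Module.Basis.reindex_apply]
  exact Module.Basis.ofSpan_subset hs (Set.mem_range_self _)

/-- An isometry of the orbit space close to the identity is induced by a translation along a
vector fixed by all linear parts of `H`. A lift `f` of such an isometry can be chosen close to
the identity near a point with trivial stabiliser. Since `f` normalises `H`, its linear part moves
each vector of a basis of the translation lattice by a short lattice vector, which is zero; for the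
same reason the linear parts of `H` fix the translation vector of `f`. -/
theorem ActsLocallyFinitely.eventually_exists_translation (hH : ActsLocallyFinitely H)
    (hspan : transSpan H = ⊤) :
    ∀ᶠ χ : OrbitSpace H ≃ᵢ OrbitSpace H in 𝓝 1, ∃ v : W, (∀ h ∈ H, linPart h v = v) ∧
      ∀ x, χ (orbitMk H x) = orbitMk H (v + x) := by
  obtain ⟨x₀, hx₀⟩ := hH.exists_trivial_stabilizer
  obtain ⟨r, hr0, hr⟩ := hH.exists_separation x₀
  obtain ⟨δ, hδ, hsep⟩ := hH.exists_lattice_separation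
  obtain ⟨b, hb⟩ := exists_basis_of_transSpan_eq_top hspan
  obtain ⟨M, hM0, hM⟩ : ∃ M : ℝ, 0 < M ∧ ∀ i, ‖b i‖ ≤ M :=
    ⟨1 + ∑ i, ‖b i‖, by positivity, fun i => by
      have := Finset.single_le_sum (f := fun i => ‖b i‖) (fun _ _ => norm_nonneg _)
        (Finset.mem_univ i)
      linarith⟩
  set t : ℝ := r / (2 * M) with ht
  have ht0 : 0 < t := by positivity
  have htM : t * M = r / 2 := by
    rw [ht]
    field_simp
  have htb : ∀ i, t * ‖b i‖ ≤ r / 2 := fun i => by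
    rw [← htM]
    exact mul_le_mul_of_nonneg_left (hM i) ht0.le
  set ε : ℝ := min (r / 2) (min (t * δ / 2) (δ / 2)) with hε
  have hε0 : 0 < ε := by positivity
  have hε1 : ε ≤ r / 2 := min_le_left _ _
  have hε2 : ε ≤ t * δ / 2 := (min_le_right _ _).trans (min_le_left _ _)
  have hε3 : ε ≤ δ / 2 := (min_le_right _ _).trans (min_le_right _ _)
  have hfin : (insert (orbitMk H x₀) (Set.range fun i => orbitMk H (x₀ + t • b i))).Finite :=
    (Set.finite_range _).insert _
  filter_upwards [isom_tendsto_iff.1 tendsto_id _ hfin.isCompact ε hε0] with χ hχ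
  have hχ0 : dist (orbitMk H x₀) (χ (orbitMk H x₀)) < ε := hχ _ (Set.mem_insert _ _)
  have hχb : ∀ i, dist (orbitMk H (x₀ + t • b i)) (χ (orbitMk H (x₀ + t • b i))) < ε := fun i =>
    hχ _ (Set.mem_insert_of_mem _ (Set.mem_range_self i))
  obtain ⟨f, hf, hfx⟩ : ∃ f : W ≃ᵃⁱ[ℝ] W, (∀ x, χ (orbitMk H x) = orbitMk H (f x)) ∧
      dist x₀ (f x₀) < ε := by
    obtain ⟨f, hf⟩ := hH.exists_lift χ
    obtain ⟨k, hk, e⟩ := hH.exists_dist_eq x₀ (f x₀)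
    refine ⟨k * f, fun x => (hf x).trans (orbitMk_apply hk _).symm, ?_⟩
    rw [hf, e] at hχ0
    exact hχ0
  have hconj : ∀ h ∈ H, f * h * f⁻¹ ∈ H := fun h hh => hH.conj_mem_of_lift hf hh
  have hfadd : ∀ u, f (x₀ + u) = f x₀ + linPart f u := fun u => by
    rw [isom_apply f, isom_apply f x₀, map_add, add_assoc]
  have hnorm : ∀ i, ‖t • b i‖ = t * ‖b i‖ := fun i => by
    rw [norm_smul, Real.norm_of_nonneg ht0.le]
  have hfb : ∀ i, dist (x₀ + t • b i) (f (x₀ + t • b i)) < ε := fun i => by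
    have h1 : dist (x₀ + t • b i) x₀ = t * ‖b i‖ := by
      rw [dist_eq_norm, add_sub_cancel_left, hnorm]
    rw [← hH.dist_eq_of_trivial_stabilizer hr hx₀, ← hf]
    · exact hχb i
    · linarith [htb i]
    · have h2 := dist_triangle (f (x₀ + t • b i)) (f x₀) x₀
      rw [f.dist_map, h1, dist_comm (f x₀)] at h2
      linarith [htb i]
  have hfix : ∀ i, linPart f (b i) = b i := fun i => by
    refine sub_eq_zero.1 (hsep _ (sub_mem (linPart_mem_translationLattice hconj (hb i)) (hb i)) ?_)
    have e : t • (linPart f (b i) - b i) =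
        (x₀ - f x₀) - (x₀ + t • b i - f (x₀ + t • b i)) := by
      rw [hfadd, map_smul, smul_sub]
      abel
    have h1 : t * ‖linPart f (b i) - b i‖ < 2 * ε := by
      rw [← Real.norm_of_nonneg ht0.le, ← norm_smul, e]
      refine (norm_sub_le _ _).trans_lt ?_
      rw [← dist_eq_norm, ← dist_eq_norm]
      linarith [hfb i]
    exact lt_of_mul_lt_mul_left (h1.trans_le (by linarith)) ht0.le
  have hlin : linPart f = LinearIsometryEquiv.refl ℝ W := linPart_eq_of_basis b hfix
  have hftr : f = transl (f 0) := by
    ext1 x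
    rw [isom_apply f x, hlin]
    rfl
  have hv : ‖f 0‖ < ε := by
    rw [hftr, dist_comm, dist_eq_norm] at hfx
    simpa using hfx
  refine ⟨f 0, fun h hh => ?_, fun x => (hf x).trans ?_⟩
  swap
  · conv_lhs => rw [hftr]
    rfl
  refine (sub_eq_zero.1 (hsep (f 0 - linPart h (f 0)) ?_ ?_)).symm
  · have e : transl (f 0 - linPart h (f 0)) = f * h * f⁻¹ * h⁻¹ := by
      conv_rhs => rw [hftr, transl_inv, mul_assoc, mul_assoc, ← mul_assoc h, conj_transl,
        transl_mul, map_neg, ← sub_eq_add_neg]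
    rw [mem_translationLattice, e]
    exact H.mul_mem (hconj h hh) (H.inv_mem hh)
  · refine (norm_sub_le _ _).trans_lt ?_
    rw [LinearIsometryEquiv.norm_map]
    linarith

/-- The point group of `H` is finite: its elements are determined by their values on a basis of
lattice vectors, and they preserve the norm and the translation lattice. -/
theorem ActsLocallyFinitely.finite_pointGroup (hH : ActsLocallyFinitely H)
    (hspan : transSpan H = ⊤) : Finite (H.map linPartHom) := by
  obtain ⟨b, hb⟩ := exists_basis_of_transSpan_eq_top hspan
  have hfin : ∀ R : ℝ, {a : W | a ∈ translationLattice H ∧ ‖a‖ ≤ R}.Finite := fun R => by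
    refine ((hH R).image fun h => h 0).subset ?_
    rintro a ⟨ha, hR⟩
    have e : transl a (0 : W) = a := add_zero a
    exact ⟨transl a, ⟨ha, by rwa [e]⟩, e⟩
  have : ∀ i, Finite {a : W // a ∈ translationLattice H ∧ ‖a‖ ≤ ‖b i‖} := fun i => hfin _
  have hmem : ∀ (g : H.map linPartHom) (i), g.1 (b i) ∈ translationLattice H ∧
      ‖g.1 (b i)‖ ≤ ‖b i‖ := by
    rintro ⟨_, h, hh, rfl⟩ i
    exact ⟨linPart_mem_translationLattice
      (fun k hk => H.mul_mem (H.mul_mem hh hk) (H.inv_mem hh)) (hb i), ((linPart h).norm_map _).le⟩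
  refine Finite.of_injective (fun g i => (⟨g.1 (b i), hmem g i⟩ :
    {a : W // a ∈ translationLattice H ∧ ‖a‖ ≤ ‖b i‖})) fun g g' e => ?_
  exact Subtype.ext (linPart_eq_of_basis b fun i => congrArg Subtype.val (congrFun e i))

/-- By averaging over the point group, the vectors fixed by the point group are spanned by fixed
lattice vectors. -/
theorem ActsLocallyFinitely.mem_span_fixed_lattice (hH : ActsLocallyFinitely H)
    (hspan : transSpan H = ⊤) {v : W} (hv : ∀ h ∈ H, linPart h v = v) :
    v ∈ Submodule.span ℝ {a | a ∈ translationLattice H ∧ ∀ h ∈ H, linPart h a = a} := by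
  have := hH.finite_pointGroup hspan
  have := Fintype.ofFinite (H.map linPartHom)
  set S : W →ₗ[ℝ] W := ∑ g : H.map linPartHom, g.1.toLinearEquiv.toLinearMap with hS
  have hSapp : ∀ u, S u = ∑ g : H.map linPartHom, g.1 u := fun u => by
    rw [hS, LinearMap.sum_apply]
    rfl
  have hSfix : ∀ u, ∀ h ∈ H, linPart h (S u) = S u := by
    intro u h hh
    rw [hSapp, map_sum]
    exact Fintype.sum_equiv (Equiv.mulLeft (⟨linPartHom h, h, hh, rfl⟩ : H.map linPartHom)) _ _
      fun g => rfl
  have hSmem : ∀ u, S u ∈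
      Submodule.span ℝ {a | a ∈ translationLattice H ∧ ∀ h ∈ H, linPart h a = a} := by
    intro u
    have hu : u ∈ transSpan H := hspan ▸ Submodule.mem_top
    induction hu using Submodule.span_induction with
    | mem a ha =>
      refine Submodule.subset_span ⟨?_, hSfix a⟩
      rw [hSapp]
      refine sum_mem ?_
      rintro ⟨_, h, hh, rfl⟩ -
      exact linPart_mem_translationLattice
        (fun k hk => H.mul_mem (H.mul_mem hh hk) (H.inv_mem hh)) ha
    | zero => rw [map_zero]; exact zero_mem _
    | add x y _ _ hx hy => rw [map_add]; exact add_mem hx hy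
    | smul c x _ hx => rw [map_smul]; exact Submodule.smul_mem _ _ hx
  have hSv : S v = (Fintype.card (H.map linPartHom) : ℝ) • v := by
    have : ∀ g : H.map linPartHom, g.1 v = v := by
      rintro ⟨_, h, hh, rfl⟩
      exact hv h hh
    rw [hSapp, Finset.sum_congr rfl fun g _ => this g, Finset.sum_const, Finset.card_univ,
      Nat.cast_smul_eq_nsmul]
  have hcard : (Fintype.card (H.map linPartHom) : ℝ) ≠ 0 := by
    exact_mod_cast Fintype.card_ne_zero
  exact (Submodule.smul_mem_iff _ hcard).1 (hSv ▸ hSmem v)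

/-- A discrete group of isometries of a Euclidean space acts locally finitely. Infinitely many
isometries moving the origin by a bounded amount would have two members that almost agree on the
vertices of a simplex, hence on every compact set. -/
theorem actsLocallyFinitely_of_discreteTopology (hd : DiscreteTopology H) :
    ActsLocallyFinitely H := by
  have hone : ∀ᶠ g : W ≃ᵃⁱ[ℝ] W in 𝓝 1, g ∈ H → g = 1 := by
    have h1 : ({1} : Set H) ∈ 𝓝 (1 : H) := (isOpen_discrete _).mem_nhds rfl
    rw [nhds_subtype_eq_comap] at h1
    obtain ⟨U, hU, hsub⟩ := h1
    filter_upwards [hU] with g hg hgH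
    exact congrArg Subtype.val (hsub (show (⟨g, hgH⟩ : H) ∈ Subtype.val ⁻¹' U from hg))
  intro R
  by_contra hinf
  have hinf : {h : W ≃ᵃⁱ[ℝ] W | h ∈ H ∧ ‖h 0‖ ≤ R}.Infinite := hinf
  let e := hinf.natEmbedding
  set Φ : (W ≃ᵃⁱ[ℝ] W) → W × (W →L[ℝ] W) := fun h =>
    (h 0, (linPart h).toLinearIsometry.toContinuousLinearMap)
  have hΦ : ∀ k, Φ (e k).1 ∈ Metric.closedBall (0 : W × (W →L[ℝ] W)) (max R 1) := fun k => by
    rw [mem_closedBall_zero_iff, Prod.norm_mk]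
    exact max_le_max (e k).2.2 (LinearIsometry.norm_toContinuousLinearMap_le _)
  obtain ⟨a, _, φ, hφ, hlim⟩ := tendsto_subseq_of_bounded Metric.isBounded_closedBall hΦ
  have hdiff : Tendsto (fun k => ‖Φ (e (φ (k + 1))).1 - Φ (e (φ k)).1‖) atTop (𝓝 0) := by
    have := ((hlim.comp (tendsto_add_atTop_nat 1)).sub hlim).norm
    rwa [sub_self, norm_zero] at this
  set g : ℕ → W ≃ᵃⁱ[ℝ] W := fun k => (e (φ (k + 1))).1⁻¹ * (e (φ k)).1
  have hg : Tendsto g atTop (𝓝 1) := by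
    rw [nhds_induced, tendsto_comap_iff]
    refine isom_tendsto_iff.2 fun K hK ε hε => ?_
    obtain ⟨C, hC0, hC⟩ := hK.isBounded.exists_pos_norm_le
    filter_upwards [hdiff.eventually_lt_const (show 0 < ε / (1 + C) by positivity)] with k hk x hx
    have e1 : dist x (g k x) = ‖(e (φ (k + 1))).1 x - (e (φ k)).1 x‖ := by
      rw [← dist_eq_norm, ← (e (φ (k + 1))).1.dist_map]
      congr 1
      exact (e (φ (k + 1))).1.apply_symm_apply _
    change dist x (g k x) < ε
    set D := Φ (e (φ (k + 1))).1 - Φ (e (φ k)).1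
    have e2 : (e (φ (k + 1))).1 x - (e (φ k)).1 x = D.1 + D.2 x := by
      rw [isom_apply (e (φ (k + 1))).1 x, isom_apply (e (φ k)).1 x, add_sub_add_comm]
      rfl
    have h1 : ‖D.2 x‖ ≤ ‖D‖ * C :=
      (D.2.le_opNorm x).trans (mul_le_mul (norm_snd_le D) (hC x hx) (norm_nonneg _) (norm_nonneg _))
    rw [lt_div_iff₀ (by positivity)] at hk
    rw [e1, e2]
    calc ‖D.1 + D.2 x‖ ≤ ‖D.1‖ + ‖D.2 x‖ := norm_add_le _ _
      _ ≤ ‖D‖ + ‖D‖ * C := add_le_add (norm_fst_le D) h1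
      _ < ε := by linarith
  obtain ⟨k, hk⟩ := (hg.eventually hone).exists
  have h1 := hk (H.mul_mem (H.inv_mem (e (φ (k + 1))).2.1) (e (φ k)).2.1)
  have h2 : e (φ (k + 1)) = e (φ k) := Subtype.ext (inv_mul_eq_one.1 h1)
  exact absurd (hφ.injective (e.injective h2)) (by simp)

end CrystallographicGroups

/-! ### Orthogonal decompositions -/

section Projection

variable {E : Type*} [NormedAddCommGroup E] [InnerProductSpace ℝ E] (U : Submodule ℝ E)
  [U.HasOrthogonalProjection]

theorem orthogonalProjectionOnto_add (v : U) (w : Uᗮ) :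
    U.orthogonalProjectionOnto ((v : E) + w) = v := by
  rw [map_add, U.orthogonalProjectionOnto_mem_subspace_eq_self v,
    U.orthogonalProjectionOnto_eq_zero_iff.2 w.2, add_zero]

theorem orthogonalProjectionOnto_orthogonal_add (v : U) (w : Uᗮ) :
    Uᗮ.orthogonalProjectionOnto ((v : E) + w) = w := by
  rw [map_add, Uᗮ.orthogonalProjectionOnto_mem_subspace_eq_self w,
    Uᗮ.orthogonalProjectionOnto_eq_zero_iff.2 (U.le_orthogonal_orthogonal v.2), zero_add]

theorem exists_add_eq (x : E) : ∃ (v : U) (w : Uᗮ), (v : E) + w = x :=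
  ⟨U.orthogonalProjectionOnto x, Uᗮ.orthogonalProjectionOnto x, by
    simp⟩

theorem add_eq_add_iff {v v' : U} {w w' : Uᗮ} :
    (v : E) + w = v' + w' ↔ v = v' ∧ w = w' := by
  refine ⟨fun h => ⟨?_, ?_⟩, by rintro ⟨rfl, rfl⟩; rfl⟩
  · rw [← orthogonalProjectionOnto_add U v w, h, orthogonalProjectionOnto_add]
  · rw [← orthogonalProjectionOnto_orthogonal_add U v w, h,
      orthogonalProjectionOnto_orthogonal_add]

end Projection

namespace SpaceGroupPair

variable {n : ℕ} (G : SpaceGroupPair n)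

/-- `Γ` acts on `V ⊕ Vᗮ` componentwise, through `γ̄` and `γ'`. -/
theorem apply_add (γ : G.Γ) (v : G.V) (w : G.Vᗮ) :
    γ.1 ((v : EuclideanSpace ℝ (Fin n)) + w) = (G.bar γ v : EuclideanSpace ℝ (Fin n)) +
      G.prime γ w := by
  obtain ⟨a, b, hab⟩ := exists_add_eq G.V (γ.1 0)
  rw [isom_apply, map_add, bar, prime, restrictHom_apply, restrictHom_apply, ← hab,
    orthogonalProjectionOnto_add, orthogonalProjectionOnto_orthogonal_add]
  exact add_add_add_comm _ _ _ _

theorem prime_eq_one_iff {ν : G.Γ} : G.prime ν = 1 ↔ ν ∈ G.N := by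
  rw [← G.ker_prime]
  rfl

theorem actsLocallyFinitely_Nbar : ActsLocallyFinitely G.Nbar := by
  intro R
  have hfin : {γ : G.Γ | ‖γ.1 0‖ ≤ R}.Finite := by
    refine ((actsLocallyFinitely_of_discreteTopology G.isSpaceGroup.discrete R).preimage
      (f := (Subtype.val : G.Γ → _)) Subtype.val_injective.injOn).subset fun γ hγ => ?_
    exact ⟨γ.2, hγ⟩
  refine (hfin.image G.bar).subset ?_
  rintro _ ⟨⟨ν, hν, rfl⟩, hR⟩
  refine ⟨ν, ?_, rfl⟩
  have h := G.apply_add ν 0 0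
  rw [G.prime_eq_one_iff.2 hν] at h
  have h' : ν.1 0 = (G.bar ν 0 : EuclideanSpace ℝ (Fin n)) := by
    simpa using h
  change ‖ν.1 0‖ ≤ R
  rw [h']
  exact hR

theorem transSpan_Nbar : transSpan G.Nbar = ⊤ := by
  refine Submodule.map_injective_of_injective G.V.injective_subtype ?_
  rw [Submodule.map_subtype_top]
  refine le_antisymm (Submodule.map_subtype_le _ _) (Submodule.span_le.2 ?_)
  rintro a ⟨ν, hν, e⟩
  have e : ν.1 = transl a := e
  have ha : a ∈ G.V := Submodule.subset_span ⟨ν, hν, e⟩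
  refine ⟨⟨a, ha⟩, Submodule.subset_span ⟨ν, hν, AffineIsometryEquiv.ext fun v => ?_⟩, rfl⟩
  have h := G.apply_add ν v 0
  rw [e, G.prime_eq_one_iff.2 hν] at h
  refine Subtype.ext (Eq.trans ?_ (h.symm.trans ?_))
  · change _ = _ + (0 : EuclideanSpace ℝ (Fin n))
    rw [add_zero]
  · change a + ((v : EuclideanSpace ℝ (Fin n)) + 0) = a + v
    rw [add_zero]

/-- `Span(Z(N))` is the fixed space of the point group of `N̄`. -/
theorem mem_Z_iff {v : G.V} : v ∈ G.Z ↔ ∀ h ∈ G.Nbar, linPart h v = v := by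
  constructor
  · rintro hv _ ⟨ν, hν, rfl⟩
    exact Subtype.ext (G.lin_spanZ ν hν hv)
  · intro hv
    refine (Submodule.span_le (p := G.Z)).2 ?_
      (G.actsLocallyFinitely_Nbar.mem_span_fixed_lattice G.transSpan_Nbar hv)
    rintro a ⟨⟨ν, hν, e⟩, ha⟩
    have hνa : ν.1 = transl (a : EuclideanSpace ℝ (Fin n)) := by
      refine AffineIsometryEquiv.ext fun x => ?_
      obtain ⟨v, w, rfl⟩ := exists_add_eq G.V x
      rw [apply_add, e, G.prime_eq_one_iff.2 hν]
      exact add_assoc _ _ _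
    refine Submodule.subset_span ⟨ν, ⟨⟨ν, hν⟩, Subgroup.mem_center_iff.2 fun μ => ?_, rfl⟩, hνa⟩
    refine Subtype.ext (Subtype.ext ?_)
    change μ.1.1 * ν.1 = ν.1 * μ.1.1
    have h := conj_transl μ.1.1 (a : EuclideanSpace ℝ (Fin n))
    have hfix : linPart μ.1.1 (a : EuclideanSpace ℝ (Fin n)) = a :=
      congrArg Subtype.val (ha (G.bar μ.1) ⟨μ.1, μ.2, rfl⟩)
    rw [hfix] at h
    rw [hνa, ← mul_inv_eq_iff_eq_mul, h]

theorem linPart_bar_mem_Z (γ : G.Γ) {v : G.V} (hv : v ∈ G.Z) : linPart (G.bar γ) v ∈ G.Z := by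
  rw [mem_Z_iff] at hv ⊢
  rintro _ ⟨ν, hν, rfl⟩
  have h := hv _ ⟨γ⁻¹ * ν * γ, by
    simpa using G.isCompleteNormal.normal.conj_mem ν hν γ⁻¹, rfl⟩
  have e : G.bar ν * G.bar γ = G.bar γ * G.bar (γ⁻¹ * ν * γ) := by
    rw [← map_mul, ← map_mul]
    congr 1
    group
  have e' : linPart (G.bar ν * G.bar γ) v = linPart (G.bar γ * G.bar (γ⁻¹ * ν * γ)) v := by rw [e]
  exact e'.trans (congrArg (linPart (G.bar γ)) h)

/-! ### The identity component of the isometry group of the orbit space -/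

theorem transStar_mk (v : G.Z) (x : G.V) :
    G.transStar v (orbitMk G.Nbar x) = orbitMk G.Nbar (v + x) := rfl

theorem isometryEquiv_ext_mk {χ ψ : G.VmodN ≃ᵢ G.VmodN}
    (h : ∀ x, χ (orbitMk G.Nbar x) = ψ (orbitMk G.Nbar x)) : χ = ψ :=
  IsometryEquiv.ext fun p => by
    obtain ⟨x, rfl⟩ := exists_orbitMk_eq p
    exact h x

theorem transStar_add (v w : G.Z) : G.transStar (v + w) = G.transStar v * G.transStar w :=
  G.isometryEquiv_ext_mk fun _ => congrArg (orbitMk G.Nbar) (add_assoc _ _ _)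

/-- The homomorphism `v ↦ (v + Ī)_⋆`, on `Span(Z(N))` as a multiplicative group. -/
def transStarHom : Multiplicative G.Z →* (G.VmodN ≃ᵢ G.VmodN) :=
  MonoidHom.mk' (fun v => G.transStar v.toAdd) fun v w => G.transStar_add v.toAdd w.toAdd

theorem continuous_transStar : Continuous G.transStar := by
  rw [continuous_iff_continuousAt]
  intro v
  refine isom_tendsto_iff.2 fun K _ ε hε => ?_
  filter_upwards [Metric.ball_mem_nhds v hε] with w hw p _
  obtain ⟨x, rfl⟩ := exists_orbitMk_eq p
  rw [transStar_mk, transStar_mk]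
  refine (dist_orbitMk_le_dist _ _).trans_lt ?_
  rw [dist_add_right, dist_comm]
  exact hw

/-- The group of the isometries `(v + Ī)_⋆` is connected, and it is open because isometries of
`V/N` near the identity are induced by translations along vectors of `Span(Z(N))`. -/
theorem K_eq_range : (G.K : Set (G.VmodN ≃ᵢ G.VmodN)) = Set.range G.transStar := by
  apply Set.Subset.antisymm
  · have hnhds : (G.transStarHom.range : Set (G.VmodN ≃ᵢ G.VmodN)) ∈ 𝓝 1 := by
      filter_upwards [G.actsLocallyFinitely_Nbar.eventually_exists_translation G.transSpan_Nbar]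
        with χ hχ
      obtain ⟨v, hv, hχ⟩ := hχ
      exact ⟨Multiplicative.ofAdd ⟨v, G.mem_Z_iff.2 hv⟩,
        G.isometryEquiv_ext_mk fun x => (hχ x).symm⟩
    have hopen := Subgroup.isOpen_of_mem_nhds G.transStarHom.range hnhds
    have hclopen : IsClopen (G.transStarHom.range : Set (G.VmodN ≃ᵢ G.VmodN)) :=
      ⟨Subgroup.isClosed_of_isOpen _ hopen, hopen⟩
    rintro χ hχ
    obtain ⟨v, rfl⟩ := hclopen.connectedComponent_subset (one_mem G.transStarHom.range) hχ
    exact ⟨v.toAdd, rfl⟩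
  · refine (isPreconnected_range G.continuous_transStar).subset_connectedComponent
      ⟨0, G.isometryEquiv_ext_mk fun _ => congrArg (orbitMk G.Nbar) (zero_add _)⟩

theorem transStar_mem_K (v : G.Z) : G.transStar v ∈ G.K :=
  G.K_eq_range.ge (Set.mem_range_self v)

theorem exists_transStar_eq {k : G.VmodN ≃ᵢ G.VmodN} (hk : k ∈ G.K) : ∃ v, G.transStar v = k :=
  G.K_eq_range.le hk

end SpaceGroupPair

/-! ### Conjugation by affinities -/

section Conjugation

variable {W : Type*} [NormedAddCommGroup W] [InnerProductSpace ℝ W]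
variable {W' : Type*} [NormedAddCommGroup W'] [InnerProductSpace ℝ W']

theorem affine_apply (α : W ≃ᵃ[ℝ] W') (x : W) : α x = α 0 + α.linear x := by
  have := α.map_vadd 0 x
  simp only [vadd_eq_add, add_zero] at this
  rw [this, add_comm]

theorem affine_add (α : W ≃ᵃ[ℝ] W') (u x : W) : α (u + x) = α.linear u + α x :=
  α.map_vadd x u

theorem affConj_eq_iff {α : W ≃ᵃ[ℝ] W'} {a : W ≃ᵃⁱ[ℝ] W} {b : W' ≃ᵃⁱ[ℝ] W'} :
    affConj α a = b.toAffineEquiv ↔ ∀ x, b (α x) = α (a x) := by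
  constructor
  · intro h x
    change b.toAffineEquiv (α x) = _
    rw [← h]
    change α (a (α.symm (α x))) = _
    rw [α.symm_apply_apply]
  · intro h
    ext y
    change α (a (α.symm y)) = b y
    rw [← h, α.apply_symm_apply]

theorem linPart_linear {α : W ≃ᵃ[ℝ] W'} {a : W ≃ᵃⁱ[ℝ] W} {b : W' ≃ᵃⁱ[ℝ] W'}
    (h : ∀ x, b (α x) = α (a x)) (u : W) : linPart b (α.linear u) = α.linear (linPart a u) := by
  have h1 := h u
  have h0 := h 0
  rw [isom_apply b] at h1 h0
  rw [affine_apply α u, map_add, ← add_assoc, h0, isom_apply a u, add_comm (a 0), affine_add,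
    add_comm] at h1
  exact add_right_cancel h1

theorem conjugates_iff {α : W ≃ᵃ[ℝ] W'} {H : Subgroup (W ≃ᵃⁱ[ℝ] W)}
    {H' : Subgroup (W' ≃ᵃⁱ[ℝ] W')} :
    Conjugates α H H' ↔ (∀ a ∈ H, ∃ b ∈ H', ∀ x, b (α x) = α (a x)) ∧
      ∀ b ∈ H', ∃ a ∈ H, ∀ x, b (α x) = α (a x) := by
  constructor
  · intro h
    constructor
    · intro a ha
      obtain ⟨b, hb, e⟩ := Eq.subset h ⟨a, ha, rfl⟩
      exact ⟨b, hb, affConj_eq_iff.1 e.symm⟩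
    · intro b hb
      obtain ⟨a, ha, e⟩ := (Eq.symm h).subset ⟨b, hb, rfl⟩
      exact ⟨a, ha, affConj_eq_iff.1 e⟩
  · rintro ⟨h₁, h₂⟩
    apply Set.Subset.antisymm
    · rintro _ ⟨a, ha, rfl⟩
      obtain ⟨b, hb, e⟩ := h₁ a ha
      exact ⟨b, hb, (affConj_eq_iff.2 e).symm⟩
    · rintro _ ⟨b, hb, rfl⟩
      obtain ⟨a, ha, e⟩ := h₂ b hb
      exact ⟨a, ha, affConj_eq_iff.2 e⟩

theorem Conjugates.linPart_fixed {α : W ≃ᵃ[ℝ] W'} {H : Subgroup (W ≃ᵃⁱ[ℝ] W)}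
    {H' : Subgroup (W' ≃ᵃⁱ[ℝ] W')} (h : Conjugates α H H') {v : W}
    (hv : ∀ a ∈ H, linPart a v = v) : ∀ b ∈ H', linPart b (α.linear v) = α.linear v := by
  intro b hb
  obtain ⟨a, ha, e⟩ := (conjugates_iff.1 h).2 b hb
  rw [linPart_linear e, hv a ha]

theorem affSharp_apply_mk {α : W ≃ᵃ[ℝ] W'} {H : Subgroup (W ≃ᵃⁱ[ℝ] W)}
    {H' : Subgroup (W' ≃ᵃⁱ[ℝ] W')} (h : Conjugates α H H') (χ : Equiv.Perm (OrbitSpace H)) (x : W) :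
    affSharp α h χ (orbitMk H' (α x)) = affStar α h (χ (orbitMk H x)) := by
  change affStar α h (χ ((affStar α h).symm (affStar α h (orbitMk H x)))) = _
  rw [Equiv.symm_apply_apply]

theorem perm_ext_affine {α : W ≃ᵃ[ℝ] W'} {H' : Subgroup (W' ≃ᵃⁱ[ℝ] W')}
    {χ ψ : Equiv.Perm (OrbitSpace H')}
    (h : ∀ x, χ (orbitMk H' (α x)) = ψ (orbitMk H' (α x))) : χ = ψ :=
  Equiv.ext fun p => by
    obtain ⟨y, rfl⟩ := exists_orbitMk_eq p
    obtain ⟨x, rfl⟩ := α.surjective y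
    exact h x

end Conjugation

/-! ### The actions on the identity components and the crossed homomorphisms -/

/-- The homomorphism forgetting that an isometry preserves distances. -/
def isomToPerm (X : Type*) [PseudoMetricSpace X] : (X ≃ᵢ X) →* Equiv.Perm X where
  toFun := IsometryEquiv.toEquiv
  map_one' := rfl
  map_mul' _ _ := rfl

/-- Permutations of a metric space that normalise a group `K` of isometries act on `K` by
conjugation. -/
theorem exists_conj_action {Q X : Type*} [Group Q] [PseudoMetricSpace X]
    (K : Subgroup (X ≃ᵢ X)) (θ : Q →* Equiv.Perm X)
    (h : ∀ q, ∀ k ∈ K, ∃ k' ∈ K, k'.toEquiv = θ q * k.toEquiv * (θ q)⁻¹) :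
    ∃ ρ : Q →* MulAut K, ∀ q (k : K),
      (ρ q k : X ≃ᵢ X).toEquiv = θ q * (k : X ≃ᵢ X).toEquiv * (θ q)⁻¹ := by
  have hinj : Function.Injective (isomToPerm X) := IsometryEquiv.toEquiv_injective
  have hθ : ∀ q, θ q ∈ Subgroup.normalizer (K.map (isomToPerm X) : Set (Equiv.Perm X)) := by
    have key : ∀ q, ∀ k ∈ K.map (isomToPerm X), θ q * k * (θ q)⁻¹ ∈ K.map (isomToPerm X) := by
      rintro q _ ⟨k, hk, rfl⟩
      exact h q k hk
    refine fun q => Subgroup.mem_normalizer_iff.2 fun k => ⟨key q k, fun hk => ?_⟩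
    have := key q⁻¹ _ hk
    rw [map_inv] at this
    simpa [mul_assoc] using this
  let e := K.equivMapOfInjective (isomToPerm X) hinj
  refine ⟨(MulAut.congr e.symm).toMonoidHom.comp
    ((K.map (isomToPerm X)).normalizerMonoidHom.comp (θ.codRestrict _ hθ)), fun q k => ?_⟩
  change isomToPerm X (e.symm _ : K) = _
  rw [← K.coe_equivMapOfInjective_apply (isomToPerm X) hinj]
  change (e (e.symm _)).1 = _
  rw [e.apply_symm_apply]
  rfl

namespace SpaceGroupPair

variable {n : ℕ}

theorem p_mul (G : SpaceGroupPair n) (γ δ : G.Γ) :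
    G.p (((γ * δ : G.Γ)) : G.Γ ⧸ G.N) =
      G.p (γ : G.Γ ⧸ G.N) + linPart (G.prime γ) (G.p (δ : G.Γ ⧸ G.N)) := by
  change G.prime (γ * δ) 0 = G.prime γ 0 + linPart (G.prime γ) (G.prime δ 0)
  rw [map_mul, ← isom_apply]
  rfl

theorem Xi_conj_transStar (G : SpaceGroupPair n) (γ : G.Γ) (v : G.Z) :
    G.Xi (γ : G.Γ ⧸ G.N) * G.transStar v * (G.Xi (γ : G.Γ ⧸ G.N))⁻¹ =
      G.transStar ⟨linPart (G.bar γ) v, G.linPart_bar_mem_Z γ v.2⟩ := by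
  rw [mul_inv_eq_iff_eq_mul]
  refine G.isometryEquiv_ext_mk fun x => ?_
  change orbitMk G.Nbar (G.bar γ (v.1 + x)) = orbitMk G.Nbar (linPart (G.bar γ) v + G.bar γ x)
  rw [isom_apply, map_add, add_left_comm, ← isom_apply]

theorem toEquiv_Xi_conj_transStar (G : SpaceGroupPair n) (γ : G.Γ) (v : G.Z) :
    (G.transStar ⟨linPart (G.bar γ) v, G.linPart_bar_mem_Z γ v.2⟩).toEquiv =
      (G.Xi (γ : G.Γ ⧸ G.N)).toEquiv * (G.transStar v).toEquiv *
        (G.Xi (γ : G.Γ ⧸ G.N)).toEquiv⁻¹ := by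
  rw [← Xi_conj_transStar]
  rfl

/-- If `θ` conjugates the translations `(v + Ī)_⋆` of `𝒦'` through the linear maps `m γ`, and the
linear map `D` intertwines these with the action of `Γ` on `Vᗮ`, then `(D p)_⋆` is a crossed
homomorphism for the action of `Γ/N` on `𝒦'` by conjugation. -/
theorem exists_crossedHom (G G' : SpaceGroupPair n) (θ : G.Γ ⧸ G.N →* Equiv.Perm G'.VmodN)
    (m : G.Γ → G'.V → G'.V) (hm : ∀ γ, ∀ v ∈ G'.Z, m γ v ∈ G'.Z)
    (hθ : ∀ (γ : G.Γ) (v : G'.Z), (G'.transStar ⟨m γ v, hm γ v v.2⟩).toEquiv =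
      θ (γ : G.Γ ⧸ G.N) * (G'.transStar v).toEquiv * (θ (γ : G.Γ ⧸ G.N))⁻¹)
    (D : G.Vᗮ →ₗ[ℝ] G'.V) (hD : ∀ w, D w ∈ G'.Z)
    (hDm : ∀ (γ : G.Γ) (w : G.Vᗮ), D (linPart (G.prime γ) w) = m γ (D w)) :
    ∃ (ρ : G.Γ ⧸ G.N →* MulAut G'.K) (f : G.Γ ⧸ G.N → G'.K),
      (∀ (γ : G.Γ) (v : G'.Z) (k : G'.K), (k : G'.VmodN ≃ᵢ G'.VmodN) = G'.transStar v →
        ∃ w : G'.Z, (w : G'.V) = m γ v ∧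
          (ρ (γ : G.Γ ⧸ G.N) k : G'.VmodN ≃ᵢ G'.VmodN) = G'.transStar w) ∧
      (∀ g, (f g : G'.VmodN ≃ᵢ G'.VmodN) = G'.transStar ⟨D (G.p g), hD _⟩) ∧
      IsCrossedHom ρ f := by
  obtain ⟨ρ, hρ⟩ := exists_conj_action G'.K θ fun q k hk => by
    obtain ⟨γ, rfl⟩ := QuotientGroup.mk_surjective q
    obtain ⟨v, rfl⟩ := G'.exists_transStar_eq hk
    exact ⟨_, G'.transStar_mem_K _, hθ γ v⟩
  have hρv : ∀ (γ : G.Γ) (v : G'.Z) (k : G'.K), (k : G'.VmodN ≃ᵢ G'.VmodN) = G'.transStar v →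
      (ρ (γ : G.Γ ⧸ G.N) k : G'.VmodN ≃ᵢ G'.VmodN) =
        G'.transStar ⟨m γ v, hm γ v v.2⟩ := fun γ v k hk =>
    IsometryEquiv.toEquiv_injective (by rw [hρ, hk, hθ])
  refine ⟨ρ, fun g => ⟨_, G'.transStar_mem_K ⟨D (G.p g), hD _⟩⟩,
    fun γ v k hk => ⟨⟨m γ v, hm γ v v.2⟩, rfl, hρv γ v k hk⟩, fun g => rfl, fun g h => ?_⟩
  obtain ⟨γ, rfl⟩ := QuotientGroup.mk_surjective g
  obtain ⟨δ, rfl⟩ := QuotientGroup.mk_surjective h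
  refine Subtype.ext ?_
  change G'.transStar _ = G'.transStar _ * (ρ _ _ : G'.VmodN ≃ᵢ G'.VmodN)
  rw [hρv γ ⟨D (G.p δ), hD _⟩ _ rfl, ← transStar_add]
  congr 1
  refine Subtype.ext ?_
  change D (G.p (((γ * δ : G.Γ)) : G.Γ ⧸ G.N)) = D (G.p γ) + m γ (D (G.p δ))
  rw [p_mul, map_add, hDm]

/-! ### Affinities conjugating one pair to another -/

section Pairs

variable {G₁ G₂ : SpaceGroupPair n} {α : G₁.V ≃ᵃ[ℝ] G₂.V}

theorem linear_mem_Z (hα : Conjugates α G₁.Nbar G₂.Nbar) {v : G₁.V} (hv : v ∈ G₁.Z) :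
    α.linear v ∈ G₂.Z :=
  G₂.mem_Z_iff.2 (hα.linPart_fixed (G₁.mem_Z_iff.1 hv))

theorem affSharp_transStar (hα : Conjugates α G₁.Nbar G₂.Nbar) (v : G₁.Z) :
    affSharp α hα (G₁.transStar v).toEquiv =
      (G₂.transStar ⟨α.linear v, linear_mem_Z hα v.2⟩).toEquiv := by
  refine perm_ext_affine (α := α) fun x => ?_
  rw [affSharp_apply_mk]
  change orbitMk G₂.Nbar (α (v.1 + x)) = orbitMk G₂.Nbar (α.linear v.1 + α x)
  rw [affine_add]

theorem P_symm_conjIso_eq_iff {β : G₁.Vᗮ ≃ᵃ[ℝ] G₂.Vᗮ} (hβ : Conjugates β G₁.Γprime G₂.Γprime)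
    (γ : G₁.Γ) (δ : G₂.Γ) :
    G₂.P.symm (conjIso β hβ (G₁.P (γ : G₁.Γ ⧸ G₁.N))) = (δ : G₂.Γ ⧸ G₂.N) ↔
      ∀ w, G₂.prime δ (β w) = β (G₁.prime γ w) := by
  rw [MulEquiv.symm_apply_eq, ← affConj_eq_iff, ← P_mk, ← P_mk, ← conjIso_spec β hβ,
    AffineIsometryEquiv.toAffineEquiv_injective.eq_iff, Subtype.ext_iff]

/-- The identity `Ξ₂(N₂ δ) = (D p₁)_⋆ α_♯ Ξ₁` at `N₁ γ`, in terms of orbits. -/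
theorem Xi_eq_iff (hα : Conjugates α G₁.Nbar G₂.Nbar) (γ : G₁.Γ) (δ : G₂.Γ) (d : G₂.Z) :
    (G₂.Xi (δ : G₂.Γ ⧸ G₂.N)).toEquiv =
        (G₂.transStar d).toEquiv * affSharp α hα (G₁.Xi (γ : G₁.Γ ⧸ G₁.N)).toEquiv ↔
      ∀ v, orbitMk G₂.Nbar (G₂.bar δ (α v)) = orbitMk G₂.Nbar (d + α (G₁.bar γ v)) := by
  have hR : ∀ v, ((G₂.transStar d).toEquiv * affSharp α hα (G₁.Xi (γ : G₁.Γ ⧸ G₁.N)).toEquiv)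
      (orbitMk G₂.Nbar (α v)) = orbitMk G₂.Nbar (d + α (G₁.bar γ v)) := fun v => by
    rw [Equiv.Perm.mul_apply, affSharp_apply_mk]
    rfl
  constructor
  · intro h v
    rw [← hR, ← h]
    rfl
  · intro h
    refine perm_ext_affine (α := α) fun v => ?_
    rw [hR, ← h]
    rfl

/-- An affinity with parts `α`, `β` and `D` that conjugates `N₁` to `N₂` is
`v + w ↦ α v + D w + β w`: its linear part takes translation vectors of `N₁` to translation
vectors of `N₂`, hence `V₁` into `V₂`. -/
theorem apply_add_of_parts {φ : EuclideanSpace ℝ (Fin n) ≃ᵃ[ℝ] EuclideanSpace ℝ (Fin n)}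
    (hN : Conjugates φ G₁.NE G₂.NE) {β : G₁.Vᗮ ≃ᵃ[ℝ] G₂.Vᗮ} {D : G₁.Vᗮ →ₗ[ℝ] G₂.V}
    (h₁ : ∀ v, affPart G₁.V G₂.V φ v = α v) (h₂ : ∀ w, affPart G₁.Vᗮ G₂.Vᗮ φ w = β w)
    (h₃ : ∀ w, affLinPart G₁.Vᗮ G₂.V φ w = D w) (v : G₁.V) (w : G₁.Vᗮ) :
    φ ((v : EuclideanSpace ℝ (Fin n)) + w) =
      ((α v + D w : G₂.V) : EuclideanSpace ℝ (Fin n)) + β w := by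
  have hV : G₁.V ≤ G₂.V.comap φ.linear.toLinearMap := by
    refine Submodule.span_le.2 fun a ha => ?_
    obtain ⟨b, hb, e⟩ := (conjugates_iff.1 hN).1 _ ha
    refine Submodule.subset_span (?_ : transl (φ.linear a) ∈ G₂.NE)
    convert hb
    refine AffineIsometryEquiv.ext fun y => ?_
    obtain ⟨x, rfl⟩ := φ.surjective y
    rw [e]
    exact (affine_add φ a x).symm
  have hCv : G₂.Vᗮ.orthogonalProjectionOnto (φ.linear v) = 0 :=
    G₂.Vᗮ.orthogonalProjectionOnto_eq_zero_iff.2 (G₂.V.le_orthogonal_orthogonal (hV v.2))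
  obtain ⟨a, b, hab⟩ := exists_add_eq G₂.V (φ ((v : EuclideanSpace ℝ (Fin n)) + w))
  have ha := orthogonalProjectionOnto_add G₂.V a b
  have hb := orthogonalProjectionOnto_orthogonal_add G₂.V a b
  rw [hab, affine_apply φ, map_add, map_add, map_add] at ha hb
  rw [hCv, zero_add] at hb
  rw [← add_assoc] at ha
  have ha' : α v + D w = a := by rw [← h₁, ← h₃]; exact ha
  have hb' : β w = b := by rw [← h₂]; exact hb
  rw [← hab, ha', hb']

/-- The affinity `v + w ↦ α v + D w + β w`. -/
theorem exists_affineEquiv_of_parts (α : G₁.V ≃ᵃ[ℝ] G₂.V) (β : G₁.Vᗮ ≃ᵃ[ℝ] G₂.Vᗮ)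
    (D : G₁.Vᗮ →ₗ[ℝ] G₂.V) :
    ∃ φ : EuclideanSpace ℝ (Fin n) ≃ᵃ[ℝ] EuclideanSpace ℝ (Fin n),
      ∀ (v : G₁.V) (w : G₁.Vᗮ), φ ((v : EuclideanSpace ℝ (Fin n)) + w) =
        ((α v + D w : G₂.V) : EuclideanSpace ℝ (Fin n)) + β w := by
  let pV : EuclideanSpace ℝ (Fin n) →ₗ[ℝ] G₁.V := G₁.V.orthogonalProjectionOnto
  let pW : EuclideanSpace ℝ (Fin n) →ₗ[ℝ] G₁.Vᗮ := G₁.Vᗮ.orthogonalProjectionOnto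
  let C : EuclideanSpace ℝ (Fin n) →ₗ[ℝ] EuclideanSpace ℝ (Fin n) :=
    G₂.V.subtype ∘ₗ (α.linear.toLinearMap ∘ₗ pV + D ∘ₗ pW) +
      G₂.Vᗮ.subtype ∘ₗ β.linear.toLinearMap ∘ₗ pW
  have hC : ∀ (v : G₁.V) (w : G₁.Vᗮ), C ((v : EuclideanSpace ℝ (Fin n)) + w) =
      ((α.linear v + D w : G₂.V) : EuclideanSpace ℝ (Fin n)) + β.linear w := by
    intro v w
    have hv : pV ((v : EuclideanSpace ℝ (Fin n)) + w) = v := orthogonalProjectionOnto_add G₁.V v w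
    have hw : pW ((v : EuclideanSpace ℝ (Fin n)) + w) = w :=
      orthogonalProjectionOnto_orthogonal_add G₁.V v w
    change ((α.linear (pV _) + D (pW _) : G₂.V) : EuclideanSpace ℝ (Fin n)) + β.linear (pW _) = _
    rw [hv, hw]
  have hinj : Function.Injective C := by
    refine (injective_iff_map_eq_zero C).2 fun x hx => ?_
    obtain ⟨v, w, rfl⟩ := exists_add_eq G₁.V x
    rw [hC] at hx
    have h0 : (0 : EuclideanSpace ℝ (Fin n)) = ((0 : G₂.V) : EuclideanSpace ℝ (Fin n)) +
      (0 : G₂.Vᗮ) := (add_zero 0).symm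
    rw [h0, add_eq_add_iff] at hx
    obtain ⟨h1, h2⟩ := hx
    have hw : w = 0 := β.linear.map_eq_zero_iff.1 h2
    rw [hw, map_zero, add_zero] at h1
    rw [hw, α.linear.map_eq_zero_iff.1 h1]
    exact add_zero 0
  refine ⟨AffineEquiv.mk' (fun x => C x + ((α 0 : G₂.V) + (β 0 : G₂.Vᗮ)))
    (LinearEquiv.ofInjectiveEndo C hinj) 0 (by intro x; simp), fun v w => ?_⟩
  change C _ + _ = _
  rw [hC, affine_apply α v, affine_apply β w]
  push_cast
  abel

theorem parts_of_apply_add {φ : EuclideanSpace ℝ (Fin n) ≃ᵃ[ℝ] EuclideanSpace ℝ (Fin n)}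
    {β : G₁.Vᗮ ≃ᵃ[ℝ] G₂.Vᗮ} {D : G₁.Vᗮ →ₗ[ℝ] G₂.V}
    (hφ : ∀ (v : G₁.V) (w : G₁.Vᗮ), φ ((v : EuclideanSpace ℝ (Fin n)) + w) =
        ((α v + D w : G₂.V) : EuclideanSpace ℝ (Fin n)) + β w) :
    (∀ v, affPart G₁.V G₂.V φ v = α v) ∧ (∀ w, affPart G₁.Vᗮ G₂.Vᗮ φ w = β w) ∧
      ∀ w, affLinPart G₁.Vᗮ G₂.V φ w = D w := by
  have hv : ∀ v : G₁.V, φ v = ((α v : G₂.V) : EuclideanSpace ℝ (Fin n)) + β 0 := fun v => by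
    simpa using hφ v 0
  have hw : ∀ w : G₁.Vᗮ, φ w = ((α 0 + D w : G₂.V) : EuclideanSpace ℝ (Fin n)) + β w :=
    fun w => by simpa using hφ 0 w
  refine ⟨fun v => ?_, fun w => ?_, fun w => ?_⟩
  · rw [affPart, ← map_add, ← affine_apply, hv, orthogonalProjectionOnto_add]
  · rw [affPart, ← map_add, ← affine_apply, hw, orthogonalProjectionOnto_orthogonal_add]
  · have h1 := congrArg G₂.V.orthogonalProjectionOnto (hw w)
    have h0 := congrArg G₂.V.orthogonalProjectionOnto (hv 0)
    rw [orthogonalProjectionOnto_add, affine_apply φ, map_add] at h1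
    rw [orthogonalProjectionOnto_add, Submodule.coe_zero] at h0
    rw [h0] at h1
    exact add_left_cancel h1

/-- An affinity `v + w ↦ α v + D w + β w` intertwines `γ` and `δ` if and only if `β` intertwines
`γ'` and `δ'` while `δ̄ α = D b' + α γ̄`. -/
theorem intertwines_iff {φ : EuclideanSpace ℝ (Fin n) ≃ᵃ[ℝ] EuclideanSpace ℝ (Fin n)}
    {β : G₁.Vᗮ ≃ᵃ[ℝ] G₂.Vᗮ} {D : G₁.Vᗮ →ₗ[ℝ] G₂.V}
    (hDB : ∀ (γ : G₁.Γ) (w : G₁.Vᗮ),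
      D (linPart (G₁.prime γ) w) = α.linear (linPart (G₁.bar γ) (α.linear.symm (D w))))
    (hφ : ∀ (v : G₁.V) (w : G₁.Vᗮ), φ ((v : EuclideanSpace ℝ (Fin n)) + w) =
        ((α v + D w : G₂.V) : EuclideanSpace ℝ (Fin n)) + β w) (γ : G₁.Γ) (δ : G₂.Γ) :
    (∀ x, δ.1 (φ x) = φ (γ.1 x)) ↔ (∀ w, G₂.prime δ (β w) = β (G₁.prime γ w)) ∧
      ∀ v, G₂.bar δ (α v) = D (G₁.p (γ : G₁.Γ ⧸ G₁.N)) + α (G₁.bar γ v) := by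
  have key : ∀ (v : G₁.V) (w : G₁.Vᗮ),
      δ.1 (φ ((v : EuclideanSpace ℝ (Fin n)) + w)) = φ (γ.1 (v + w)) ↔
        G₂.bar δ (α v + D w) = α (G₁.bar γ v) + D (G₁.prime γ w) ∧
          G₂.prime δ (β w) = β (G₁.prime γ w) := by
    intro v w
    rw [hφ, apply_add, apply_add, hφ, add_eq_add_iff]
  constructor
  · intro h
    refine ⟨fun w => ((key 0 w).1 (h _)).2, fun v => ?_⟩
    have := ((key v 0).1 (h _)).1
    rwa [map_zero, add_zero, add_comm] at this
  · rintro ⟨h', h⟩ x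
    obtain ⟨v, w, rfl⟩ := exists_add_eq G₁.V x
    refine (key v w).2 ⟨?_, h' w⟩
    -- the linear parts of `δ̄` and `γ̄` are conjugate under that of `α`
    have hlin : linPart (G₂.bar δ) (D w) = D (linPart (G₁.prime γ) w) := by
      rw [hDB]
      have h1 := h (α.symm (α 0 + D w))
      have h0 := h 0
      have e : α.symm (α 0 + D w) = α.linear.symm (D w) := by
        rw [AffineEquiv.symm_apply_eq, affine_apply α (α.linear.symm (D w)),
          LinearEquiv.apply_symm_apply]
      rw [AffineEquiv.apply_symm_apply, e, isom_apply, map_add, ← add_assoc, ← isom_apply, h0,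
        isom_apply (G₁.bar γ) (α.linear.symm _), add_comm (G₁.bar γ 0), affine_add,
        add_left_comm, add_comm] at h1
      exact add_right_cancel h1
    rw [isom_apply, map_add, ← add_assoc, ← isom_apply, h v, hlin, isom_apply (G₁.prime γ) w,
      map_add]
    change D (G₁.prime γ 0) + _ + _ = _
    abel

end Pairs

end SpaceGroupPair

/-! ### The compatibility condition -/

namespace SpaceGroupPair

variable {n : ℕ} {G₁ G₂ : SpaceGroupPair n} {α : G₁.V ≃ᵃ[ℝ] G₂.V} {β : G₁.Vᗮ ≃ᵃ[ℝ] G₂.Vᗮ}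
  {D : G₁.Vᗮ →ₗ[ℝ] G₂.V}

/-- Necessity of the compatibility condition: if `φ` conjugates `γ` to `δ`, then
`P₂⁻¹ β_∗ P₁ (N₁ γ) = N₂ δ`, and `δ̄ α = D b' + α γ̄` on `V₁`. -/
theorem Xi_eq_of_conjugates (hα : Conjugates α G₁.Nbar G₂.Nbar)
    (hβ : Conjugates β G₁.Γprime G₂.Γprime) (hD : ∀ w, D w ∈ G₂.Z)
    (hDB : ∀ (γ : G₁.Γ) (w : G₁.Vᗮ),
      D (linPart (G₁.prime γ) w) = α.linear (linPart (G₁.bar γ) (α.linear.symm (D w))))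
    {φ : EuclideanSpace ℝ (Fin n) ≃ᵃ[ℝ] EuclideanSpace ℝ (Fin n)} (hΓ : Conjugates φ G₁.Γ G₂.Γ)
    (hφ : ∀ (v : G₁.V) (w : G₁.Vᗮ), φ ((v : EuclideanSpace ℝ (Fin n)) + w) =
        ((α v + D w : G₂.V) : EuclideanSpace ℝ (Fin n)) + β w) (g : G₁.Γ ⧸ G₁.N) :
    (G₂.Xi (G₂.P.symm (conjIso β hβ (G₁.P g)))).toEquiv =
      (G₂.transStar ⟨D (G₁.p g), hD _⟩).toEquiv * affSharp α hα (G₁.Xi g).toEquiv := by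
  obtain ⟨γ, rfl⟩ := QuotientGroup.mk_surjective g
  obtain ⟨δ, hδ, e⟩ := (conjugates_iff.1 hΓ).1 γ.1 γ.2
  obtain ⟨h', h⟩ := (intertwines_iff hDB hφ γ ⟨δ, hδ⟩).1 e
  rw [(P_symm_conjIso_eq_iff hβ γ ⟨δ, hδ⟩).2 h', Xi_eq_iff]
  exact fun v => by rw [h]

/-- Sufficiency of the compatibility condition. An element `δ` of `Γ₂` with `δ' = β γ' β⁻¹` has
`δ̄ α` and `D b' + α γ̄` in the same `N̄₂`-orbits, so these affine maps differ by an element of `N̄₂`;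
after correction by it, `δ` is the conjugate of `γ`. -/
theorem conjugates_of_Xi_eq (hα : Conjugates α G₁.Nbar G₂.Nbar)
    (hβ : Conjugates β G₁.Γprime G₂.Γprime) (hD : ∀ w, D w ∈ G₂.Z)
    (hDB : ∀ (γ : G₁.Γ) (w : G₁.Vᗮ),
      D (linPart (G₁.prime γ) w) = α.linear (linPart (G₁.bar γ) (α.linear.symm (D w))))
    {φ : EuclideanSpace ℝ (Fin n) ≃ᵃ[ℝ] EuclideanSpace ℝ (Fin n)}
    (hφ : ∀ (v : G₁.V) (w : G₁.Vᗮ), φ ((v : EuclideanSpace ℝ (Fin n)) + w) =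
        ((α v + D w : G₂.V) : EuclideanSpace ℝ (Fin n)) + β w)
    (hΞ : ∀ g : G₁.Γ ⧸ G₁.N, (G₂.Xi (G₂.P.symm (conjIso β hβ (G₁.P g)))).toEquiv =
      (G₂.transStar ⟨D (G₁.p g), hD _⟩).toEquiv * affSharp α hα (G₁.Xi g).toEquiv) :
    Conjugates φ G₁.Γ G₂.Γ ∧ Conjugates φ G₁.NE G₂.NE := by
  have hmap : ∀ γ : G₁.Γ, ∃ δ : G₂.Γ, ∀ x, δ.1 (φ x) = φ (γ.1 x) := by
    intro γ
    obtain ⟨δ, hδ⟩ := QuotientGroup.mk_surjective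
      (G₂.P.symm (conjIso β hβ (G₁.P (γ : G₁.Γ ⧸ G₁.N))))
    have h' := (P_symm_conjIso_eq_iff hβ γ δ).1 hδ.symm
    have h := hΞ γ
    rw [← hδ, Xi_eq_iff] at h
    obtain ⟨_, ⟨ν, hν, rfl⟩, e⟩ := G₂.actsLocallyFinitely_Nbar.exists_comp_eq
      ((G₂.bar δ).toAffineEquiv.toAffineMap.comp α.toAffineMap)
      (AffineMap.const ℝ G₁.V (D (G₁.p (γ : G₁.Γ ⧸ G₁.N))) +
        α.toAffineMap.comp (G₁.bar γ).toAffineEquiv.toAffineMap)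
      isOpen_univ Set.univ_nonempty fun v _ => h v
    refine ⟨ν * δ, (intertwines_iff hDB hφ γ (ν * δ)).2 ⟨fun w => ?_, fun v => ?_⟩⟩
    · rw [map_mul, G₂.prime_eq_one_iff.2 hν, one_mul, h']
    · rw [map_mul]
      exact e v
  have hprime : ∀ {γ : G₁.Γ} {δ : G₂.Γ}, (∀ x, δ.1 (φ x) = φ (γ.1 x)) →
      ∀ w, G₂.prime δ (β w) = β (G₁.prime γ w) := fun e =>
    ((intertwines_iff hDB hφ _ _).1 e).1
  have hmemN : ∀ {γ : G₁.Γ} {δ : G₂.Γ}, (∀ x, δ.1 (φ x) = φ (γ.1 x)) → γ ∈ G₁.N → δ ∈ G₂.N := by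
    intro γ δ e hγ
    refine G₂.prime_eq_one_iff.1 (AffineIsometryEquiv.ext fun y => ?_)
    obtain ⟨w, rfl⟩ := β.surjective y
    rw [hprime e, G₁.prime_eq_one_iff.2 hγ]
    rfl
  have hN : ∀ μ ∈ G₂.N, ∃ ν ∈ G₁.N, ∀ x, μ.1 (φ x) = φ (ν.1 x) := by
    intro μ hμ
    obtain ⟨_, ⟨ν, hν, rfl⟩, e⟩ := (conjugates_iff.1 hα).2 (G₂.bar μ) ⟨μ, hμ, rfl⟩
    refine ⟨ν, hν, (intertwines_iff hDB hφ ν μ).2 ⟨fun w => ?_, fun v => ?_⟩⟩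
    · rw [G₂.prime_eq_one_iff.2 hμ, G₁.prime_eq_one_iff.2 hν]
      rfl
    · have hp : G₁.p (ν : G₁.Γ ⧸ G₁.N) = 0 := by
        change G₁.prime ν 0 = 0
        rw [G₁.prime_eq_one_iff.2 hν]
        rfl
      rw [hp, map_zero, zero_add, e]
  refine ⟨conjugates_iff.2 ⟨fun a ha => ?_, fun b hb => ?_⟩,
    conjugates_iff.2 ⟨?_, ?_⟩⟩
  · obtain ⟨δ, e⟩ := hmap ⟨a, ha⟩
    exact ⟨δ.1, δ.2, e⟩
  · obtain ⟨_, ⟨γ, rfl⟩, e⟩ := (conjugates_iff.1 hβ).2 (G₂.prime ⟨b, hb⟩) ⟨⟨b, hb⟩, rfl⟩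
    obtain ⟨δ, hδ⟩ := hmap γ
    have hμ : ⟨b, hb⟩ * δ⁻¹ ∈ G₂.N := by
      rw [← G₂.prime_eq_one_iff, map_mul, map_inv, mul_inv_eq_one]
      refine AffineIsometryEquiv.ext fun y => ?_
      obtain ⟨w, rfl⟩ := β.surjective y
      rw [e, hprime hδ]
    obtain ⟨ν, _, hν⟩ := hN _ hμ
    refine ⟨ν.1 * γ.1, (ν * γ).2, fun x => ?_⟩
    change b (φ x) = φ (ν.1 (γ.1 x))
    rw [← hν, ← hδ]
    change b (φ x) = b (δ.1.symm (δ.1 (φ x)))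
    rw [AffineIsometryEquiv.symm_apply_apply]
  · rintro _ ⟨ν, hν, rfl⟩
    obtain ⟨δ, e⟩ := hmap ν
    exact ⟨δ.1, ⟨δ, hmemN e hν, rfl⟩, e⟩
  · rintro _ ⟨μ, hμ, rfl⟩
    obtain ⟨ν, hν, e⟩ := hN μ hμ
    exact ⟨ν.1, ⟨ν, hν, rfl⟩, e⟩

end SpaceGroupPair

end

theorem theorem3 {n : ℕ} (G₁ G₂ : SpaceGroupPair n)
    -- the affinities `α : V₁ → V₂` and `β : V₁ᗮ → V₂ᗮ`
    (α : G₁.V ≃ᵃ[ℝ] G₂.V) (hα : Conjugates α G₁.Nbar G₂.Nbar)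
    (β : G₁.Vᗮ ≃ᵃ[ℝ] G₂.Vᗮ) (hβ : Conjugates β G₁.Γprime G₂.Γprime)
    -- the linear map `D : V₁ᗮ → Span(Z(N₂))` with `D B' = C̄ B̄ C̄⁻¹ D`, where `α = c̄ + C̄`
    (D : G₁.Vᗮ →ₗ[ℝ] G₂.V) (hD : ∀ w, D w ∈ G₂.Z)
    (hDB : ∀ (γ : G₁.Γ) (w : G₁.Vᗮ),
      D (linPart (G₁.prime γ) w) = α.linear (linPart (G₁.bar γ) (α.linear.symm (D w)))) :
    -- `𝒦ᵢ` consists of the maps `(v + Ī)_⋆` with `v` in `Span(Z(Nᵢ))`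
    (G₁.K : Set (G₁.VmodN ≃ᵢ G₁.VmodN)) = Set.range G₁.transStar ∧
    (G₂.K : Set (G₂.VmodN ≃ᵢ G₂.VmodN)) = Set.range G₂.transStar ∧
    -- `Γ₁/N₁` acts on `𝒦₂`, and `(D p₁)_⋆` is a crossed homomorphism into `𝒦₂`
    (∃ (ρ : G₁.Γ ⧸ G₁.N →* MulAut G₂.K) (f : G₁.Γ ⧸ G₁.N → G₂.K),
      (∀ (γ : G₁.Γ) (v : G₂.Z) (k : G₂.K), (k : G₂.VmodN ≃ᵢ G₂.VmodN) = G₂.transStar v →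
        ∃ w : G₂.Z, (w : G₂.V) = α.linear (linPart (G₁.bar γ) (α.linear.symm (v : G₂.V))) ∧
          (ρ (γ : G₁.Γ ⧸ G₁.N) k : G₂.VmodN ≃ᵢ G₂.VmodN) = G₂.transStar w) ∧
      (∀ g, (f g : G₂.VmodN ≃ᵢ G₂.VmodN) = G₂.transStar ⟨D (G₁.p g), hD _⟩) ∧
      IsCrossedHom ρ f) ∧
    -- the map `C̄⁻¹ D` takes values in `Span(Z(N₁))`
    ∃ hE : ∀ w, α.linear.symm (D w) ∈ G₁.Z,
      -- `Γ₁/N₁` acts on `𝒦₁`, and `(C̄⁻¹ D p₁)_⋆` is a crossed homomorphism into `𝒦₁`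
      (∃ (ρ : G₁.Γ ⧸ G₁.N →* MulAut G₁.K) (f : G₁.Γ ⧸ G₁.N → G₁.K),
        (∀ (γ : G₁.Γ) (v : G₁.Z) (k : G₁.K), (k : G₁.VmodN ≃ᵢ G₁.VmodN) = G₁.transStar v →
          ∃ w : G₁.Z, (w : G₁.V) = linPart (G₁.bar γ) (v : G₁.V) ∧
            (ρ (γ : G₁.Γ ⧸ G₁.N) k : G₁.VmodN ≃ᵢ G₁.VmodN) = G₁.transStar w) ∧
        (∀ g, (f g : G₁.VmodN ≃ᵢ G₁.VmodN) =
          G₁.transStar ⟨α.linear.symm (D (G₁.p g)), hE _⟩) ∧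
        IsCrossedHom ρ f) ∧
      List.TFAE [
        -- (1) an affinity `φ = c + C` conjugates `(Γ₁, N₁)` to `(Γ₂, N₂)`,
        -- with `φ̄ = α`, `φ' = β` and `C̄' = D`
        ∃ φ : EuclideanSpace ℝ (Fin n) ≃ᵃ[ℝ] EuclideanSpace ℝ (Fin n),
          Conjugates φ G₁.Γ G₂.Γ ∧ Conjugates φ G₁.NE G₂.NE ∧
          (∀ v, affPart G₁.V G₂.V φ v = α v) ∧
          (∀ w, affPart G₁.Vᗮ G₂.Vᗮ φ w = β w) ∧
          (∀ w, affLinPart G₁.Vᗮ G₂.V φ w = D w),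
        -- (2) `Ξ₂ P₂⁻¹ β_∗ P₁ = (D p₁)_⋆ α_♯ Ξ₁`
        ∀ g : G₁.Γ ⧸ G₁.N,
          (G₂.Xi (G₂.P.symm (conjIso β hβ (G₁.P g)))).toEquiv =
            (G₂.transStar ⟨D (G₁.p g), hD _⟩).toEquiv * affSharp α hα (G₁.Xi g).toEquiv,
        -- (3) `α_♯⁻¹ Ξ₂ P₂⁻¹ β_∗ P₁ = (C̄⁻¹ D p₁)_⋆ Ξ₁`
        ∀ g : G₁.Γ ⧸ G₁.N,
          (affSharp α hα).symm (G₂.Xi (G₂.P.symm (conjIso β hβ (G₁.P g)))).toEquiv =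
            (G₁.transStar ⟨α.linear.symm (D (G₁.p g)), hE _⟩).toEquiv * (G₁.Xi g).toEquiv] := by
  have hE : ∀ w, α.linear.symm (D w) ∈ G₁.Z := fun w =>
    SpaceGroupPair.linear_mem_Z (α := α.symm) hα.symm (hD w)
  refine ⟨G₁.K_eq_range, G₂.K_eq_range, ?_, hE, ?_, ?_⟩
  · have hm : ∀ (γ : G₁.Γ), ∀ v ∈ G₂.Z,
        α.linear (linPart (G₁.bar γ) (α.linear.symm v)) ∈ G₂.Z := fun γ v hv =>
      SpaceGroupPair.linear_mem_Z hα (G₁.linPart_bar_mem_Z γ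
        (SpaceGroupPair.linear_mem_Z (α := α.symm) hα.symm hv))
    refine SpaceGroupPair.exists_crossedHom G₁ G₂
      ((affSharp α hα).toMonoidHom.comp ((isomToPerm _).comp G₁.Xi))
      (fun γ v => α.linear (linPart (G₁.bar γ) (α.linear.symm v))) hm (fun γ v => ?_) D hD hDB
    -- `α_♯` carries the corresponding identity for `G₁` over to `G₂`
    set u : G₁.Z := ⟨α.linear.symm v,
      SpaceGroupPair.linear_mem_Z (α := α.symm) hα.symm v.2⟩ with hu
    have hv : v = ⟨α.linear u, SpaceGroupPair.linear_mem_Z hα u.2⟩ :=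
      Subtype.ext (α.linear.apply_symm_apply v.1).symm
    have h := congrArg (affSharp α hα) (G₁.toEquiv_Xi_conj_transStar γ u)
    rw [map_mul, map_mul, map_inv, SpaceGroupPair.affSharp_transStar,
      SpaceGroupPair.affSharp_transStar, ← hv] at h
    exact h
  · refine SpaceGroupPair.exists_crossedHom G₁ G₁ ((isomToPerm _).comp G₁.Xi)
      (fun γ v => linPart (G₁.bar γ) v) (fun γ v hv => G₁.linPart_bar_mem_Z γ hv)
      (fun γ v => ?_) (α.linear.symm.toLinearMap ∘ₗ D) hE fun γ w => ?_
    · exact G₁.toEquiv_Xi_conj_transStar γ v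
    · change α.linear.symm (D _) = _
      rw [hDB, LinearEquiv.symm_apply_apply]
      rfl
  · tfae_have 1 → 2 := by
      rintro ⟨φ, hΓ, hN, h₁, h₂, h₃⟩
      exact SpaceGroupPair.Xi_eq_of_conjugates hα hβ hD hDB hΓ
        (SpaceGroupPair.apply_add_of_parts hN h₁ h₂ h₃)
    tfae_have 2 → 1 := by
      intro hΞ
      obtain ⟨φ, hφ⟩ := SpaceGroupPair.exists_affineEquiv_of_parts α β D
      obtain ⟨hΓ, hN⟩ := SpaceGroupPair.conjugates_of_Xi_eq hα hβ hD hDB hφ hΞ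
      exact ⟨φ, hΓ, hN, SpaceGroupPair.parts_of_apply_add hφ⟩
    tfae_have 2 ↔ 3 := by
      refine forall_congr' fun g => ?_
      have ht : affSharp α hα (G₁.transStar ⟨α.linear.symm (D (G₁.p g)), hE _⟩).toEquiv =
          (G₂.transStar ⟨D (G₁.p g), hD _⟩).toEquiv := by
        rw [SpaceGroupPair.affSharp_transStar]
        congr 2
        exact Subtype.ext (α.linear.apply_symm_apply _)
      rw [MulEquiv.symm_apply_eq, map_mul, ht]
    tfae_finish
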